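/- Let $\mathbb{R}^{3,1}$ be Minkowski $4$-space with the bilinear form $\langle x,y\rangle=-x_0y_0+x_1y_1+x_2y_2+x_3y_3$, let $\mathfrak p=(1,0,0,1)$, and let isotropic $3$-space be $$\mathbb{I}^3=\{x\in\mathbb{R}^{3,1}:\langle x,\mathfrak p\rangle=0\}=\{(l,x,y,l)\},$$ with coordinates $(l,x,y)$ and induced degenerate metric $dx^2+dy^2$. Its isometries are the maps $x\mapsto Ax+b$ with $A\in SO(3,1)$, $A\mathfrak p=\mathfrak p$, $b\in\mathbb{I}^3$; its homotheties are the maps $x\mapsto c+r(x-c)$ with $c\in\mathbb{I}^3$ and real ratio $r\neq0$. Let $\Sigma$ be a simply connected domain in the plane and let $X:\Sigma\to\mathbb{I}^3$ be a smooth spacelike immersion (its induced metric $\mathrm I$ is positive definite). Let $n$ be its lightlike Gauss map, that is, the unique map $n:\Sigma\to\mathbb{R}^{3,1}$ with $\langle n,n\rangle=0$, $\langle dX,n\rangle=0$, $\langle n,\mathfrak p\rangle=1$, and let $\mathrm{II}=\langle D^2X,n\rangle$ be its second fundamental form. Suppose that $X$ has zero mean curvature, $H=\tfrac12\operatorname{tr}_{\mathrm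 I}\mathrm{II}\equiv0$, and planar curvature lines: every curvature line (a regular curve of non-umbilic points whose tangent is everywhere a principal direction of $\mathrm{II}$ with respect to $\mathrm I$) is mapped by $X$ into an affine plane of $\mathbb{I}^3$. For Weierstrass data $(h,\eta\,dz)$ with $\eta$ and $h\eta$ entire, consider the surface $z\mapsto\operatorname{Re}\int_0^z(h,1,-i)\,\eta\,dz$, $z\in\mathbb{C}$, in the coordinates $(l,x,y)$. Then, up to isometries and homotheties of $\mathbb{I}^3$, $X$ is a piece of one, and only one, of the following: 1. the plane, with data $(0,\,dz)$; 2. the trivial Enneper-type surface, with data $(z,\,dz)$; 3. the catenoid, with data $(e^{z},\,e^{-z}dz)$; 4. the Enneper-type surface, with data $(\tfrac1z,\,z^2dz)$; 5. one of the Bonnet-type surfaces, with data $\left(\tfrac{\alpha}{\beta}\coth\tfrac{\alpha z}{2},\ \tfrac{2\beta}{\alpha^2}\sinh^2\tfrac{\alpha z}{2}\,dz\right)$ for some real $\alpha,\beta>0$. Here "$X$ is, up to isometries and homotheties, a piece of the surface $Y$" means that $X=\Phi\circ Y\circ\psi$ on $\Sigma$ for some composition $\Phi$ of isometries and homotheties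 of $\mathbb{I}^3$ and some smooth local diffeomorphism $\psi:\Sigma\to\mathbb{C}$. -/

import Mathlib

open scoped ContDiff

namespace IsotropicZMC

noncomputable section

/-! ### Minkowski 4-space and isotropic 3-space -/

/-- The underlying real vector space of Minkowski 4-space. -/
abbrev R31 : Type := Fin 4 → ℝ

/-- The Minkowski bilinear form of signature `(- + + +)`. -/
def mink (x y : R31) : ℝ := -(x 0 * y 0) + x 1 * y 1 + x 2 * y 2 + x 3 * y 3

/-- The lightlike vector `𝔭 = (1, 0, 0, 1)`. -/
def pVec : R31 := ![1, 0, 0, 1]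

/-- Isotropic 3-space: the degenerate hyperplane `{x : ⟨x, 𝔭⟩ = 0}` of Minkowski 4-space,
equivalently the set of all points `(l, x, y, l)`. -/
def isotropicSpace : Submodule ℝ R31 where
  carrier := {x | mink x pVec = 0}
  zero_mem' := by simp [mink, pVec]
  add_mem' := by
    intro a b ha hb
    simp only [Set.mem_ofPred_eq, mink, pVec, Pi.add_apply] at *
    linear_combination ha + hb
  smul_mem' := by
    intro c a ha
    simp only [Set.mem_ofPred_eq, mink, pVec, Pi.smul_apply, smul_eq_mul] at *
    linear_combination c * ha

/-- The point of isotropic 3-space with coordinates `(l, x, y)`. -/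
def ofCoords (l x y : ℝ) : R31 := ![l, x, y, l]

/-- The linear parts of the isometries of isotropic 3-space:
the matrices `A ∈ SO(3,1)` with `A 𝔭 = 𝔭`. -/
def IsLinearIsometry (A : Matrix (Fin 4) (Fin 4) ℝ) : Prop :=
  (∀ x y : R31, mink (A.mulVec x) (A.mulVec y) = mink x y) ∧ A.det = 1 ∧ A.mulVec pVec = pVec

/-- The group generated by the isometries `x ↦ A x + b` and the homotheties `x ↦ c + r (x - c)`,
`r ≠ 0`, of isotropic 3-space. Its elements are the maps `x ↦ r (A x) + b`. -/
def IsSimilarity (Φ : R31 → R31) : Prop :=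
  ∃ (r : ℝ) (A : Matrix (Fin 4) (Fin 4) ℝ) (b : R31), r ≠ 0 ∧ IsLinearIsometry A ∧
    b ∈ isotropicSpace ∧ ∀ x, Φ x = r • A.mulVec x + b

/-! ### Surface theory

The real parameter plane is `ℂ`, with `z = u + i v`. Parametrizations are arbitrary:
they are not assumed to be conformal. -/

/-- The first fundamental form of `X` at `z`. -/
def firstForm (X : ℂ → R31) (z v w : ℂ) : ℝ := mink (fderiv ℝ X z v) (fderiv ℝ X z w)

/-- `X` is a smooth spacelike immersion of the open set `S` into isotropic 3-space:
the induced metric is positive definite (so that `X` is an immersion). -/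
structure IsSpacelikeImmersion (S : Set ℂ) (X : ℂ → R31) : Prop where
  smooth : ContDiffOn ℝ ∞ X S
  mem : ∀ z ∈ S, X z ∈ isotropicSpace
  spacelike : ∀ z ∈ S, ∀ v : ℂ, v ≠ 0 → 0 < firstForm X z v v

/-- `n` is the value at `z` of the lightlike Gauss map of `X`:
`⟨n, n⟩ = 0`, `⟨dX, n⟩ = 0` and `⟨n, 𝔭⟩ = 1`. -/
def IsLightlikeNormal (X : ℂ → R31) (z : ℂ) (n : R31) : Prop :=
  mink n n = 0 ∧ (∀ v : ℂ, mink (fderiv ℝ X z v) n = 0) ∧ mink n pVec = 1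

/-- The lightlike Gauss map. -/
def gaussMap (X : ℂ → R31) (z : ℂ) : R31 := Classical.epsilon (IsLightlikeNormal X z)

theorem fderiv_mem_isotropicSpace {S : Set ℂ} {X : ℂ → R31} (hS : IsOpen S)
    (hX : IsSpacelikeImmersion S X) {z : ℂ} (hz : z ∈ S) (v : ℂ) :
    fderiv ℝ X z v ∈ isotropicSpace := by
  have hd : HasFDerivAt X (fderiv ℝ X z) z :=
    (((hX.smooth.contDiffAt (hS.mem_nhds hz)).differentiableAt (by simp))).hasFDerivAt
  have h0 := (hasFDerivAt_pi'.1 hd) 0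
  have h3 := (hasFDerivAt_pi'.1 hd) 3
  have he : (fun x => X x 0) =ᶠ[nhds z] (fun x => X x 3) := by
    filter_upwards [hS.mem_nhds hz] with x hx
    have := hX.mem x hx
    change mink (X x) pVec = 0 at this
    simp [mink, pVec] at this
    linarith
  have h := (h0.congr_of_eventuallyEq he.symm).unique h3
  have h' := congrArg (fun L : ℂ →L[ℝ] ℝ => L v) h
  simp at h'
  change mink _ pVec = 0
  simp [mink, pVec, h']

/-- The lightlike Gauss map exists and is unique. -/
theorem existsUnique_lightlikeNormal {S : Set ℂ} {X : ℂ → R31} (hS : IsOpen S)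
    (hX : IsSpacelikeImmersion S X) {z : ℂ} (hz : z ∈ S) :
    ∃! n, IsLightlikeNormal X z n := by
  have hlin : ∀ v : ℂ, fderiv ℝ X z v =
      v.re • fderiv ℝ X z 1 + v.im • fderiv ℝ X z Complex.I := by
    intro v
    rw [← map_smul, ← map_smul, ← map_add]
    congr 1
    apply Complex.ext <;> simp
  have m1 : mink (fderiv ℝ X z 1) pVec = 0 := fderiv_mem_isotropicSpace hS hX hz 1
  have m2 : mink (fderiv ℝ X z Complex.I) pVec = 0 :=
    fderiv_mem_isotropicSpace hS hX hz Complex.I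
  have hpos : ∀ s t : ℝ, (s ≠ 0 ∨ t ≠ 0) →
      0 < mink (s • fderiv ℝ X z 1 + t • fderiv ℝ X z Complex.I)
        (s • fderiv ℝ X z 1 + t • fderiv ℝ X z Complex.I) := by
    intro s t hst
    have := hX.spacelike z hz ⟨s, t⟩ (by
      intro h
      rw [Complex.ext_iff] at h
      simp at h
      tauto)
    rw [firstForm, hlin] at this
    exact this
  have hn : ∀ n : R31, (∀ v : ℂ, mink (fderiv ℝ X z v) n = 0) ↔
      (mink (fderiv ℝ X z 1) n = 0 ∧ mink (fderiv ℝ X z Complex.I) n = 0) := by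
    intro n
    refine ⟨fun h => ⟨h _, h _⟩, fun ⟨h1, h2⟩ v => ?_⟩
    rw [hlin]
    simp only [mink, Pi.add_apply, Pi.smul_apply, smul_eq_mul] at *
    linear_combination v.re * h1 + v.im * h2
  simp only [IsLightlikeNormal, hn]
  generalize fderiv ℝ X z 1 = a at *
  generalize fderiv ℝ X z Complex.I = b at *
  simp only [mink, pVec, Pi.add_apply, Pi.smul_apply, smul_eq_mul] at *
  simp at m1 m2
  have ha : a 3 = a 0 := by linarith
  have hb : b 3 = b 0 := by linarith
  simp only [ha, hb] at hpos
  have hD : a 1 * b 2 - a 2 * b 1 ≠ 0 := by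
    intro hD
    by_cases h : a 1 = 0 ∧ b 1 = 0
    · by_cases h' : a 2 = 0 ∧ b 2 = 0
      · have := hpos 1 0 (by simp)
        rw [h.1, h'.1, h.2, h'.2] at this
        nlinarith
      · have := hpos (b 2) (-(a 2)) (by simp; tauto)
        rw [h.1, h.2] at this
        nlinarith
    · have := hpos (b 1) (-(a 1)) (by simp; tauto)
      have e : b 1 * a 2 + -a 1 * b 2 = 0 := by linarith
      rw [e] at this
      nlinarith
  set n1 := (a 2 * b 0 - b 2 * a 0) / (a 1 * b 2 - a 2 * b 1)
  set n2 := (b 1 * a 0 - a 1 * b 0) / (a 1 * b 2 - a 2 * b 1)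
  have p1 : n1 * (a 1 * b 2 - a 2 * b 1) = a 2 * b 0 - b 2 * a 0 := div_mul_cancel₀ _ hD
  have p2 : n2 * (a 1 * b 2 - a 2 * b 1) = b 1 * a 0 - a 1 * b 0 := div_mul_cancel₀ _ hD
  have e1 : a 0 + a 1 * n1 + a 2 * n2 = 0 := by
    refine mul_right_cancel₀ hD ?_
    linear_combination a 1 * p1 + a 2 * p2
  have e2 : b 0 + b 1 * n1 + b 2 * n2 = 0 := by
    refine mul_right_cancel₀ hD ?_
    linear_combination b 1 * p1 + b 2 * p2
  refine ⟨![-(1 + n1 ^ 2 + n2 ^ 2) / 2, n1, n2, (1 - n1 ^ 2 - n2 ^ 2) / 2], ?_, ?_⟩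
  · simp [ha, hb]
    refine ⟨by ring, ⟨by linear_combination e1, by linear_combination e2⟩, by ring⟩
  · rintro m ⟨k1, ⟨k2, k3⟩, k4⟩
    simp at k4
    rw [ha] at k2
    rw [hb] at k3
    have f1 : (m 1 - n1) * (a 1 * b 2 - a 2 * b 1) = 0 := by
      linear_combination b 2 * k2 - a 2 * k3 - b 2 * e1 + a 2 * e2 +
        (a 2 * b 0 - b 2 * a 0) * k4
    have f2 : (m 2 - n2) * (a 1 * b 2 - a 2 * b 1) = 0 := by
      linear_combination -b 1 * k2 + a 1 * k3 + b 1 * e1 - a 1 * e2 -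
        (a 1 * b 0 - b 1 * a 0) * k4
    have g1 : m 1 = n1 := by
      rcases mul_eq_zero.1 f1 with h | h
      · linarith
      · exact absurd h hD
    have g2 : m 2 = n2 := by
      rcases mul_eq_zero.1 f2 with h | h
      · linarith
      · exact absurd h hD
    have g3 : m 3 + m 0 = -(n1 ^ 2 + n2 ^ 2) := by
      rw [g1, g2] at k1
      linear_combination k1 - (m 3 + m 0) * k4
    funext i
    fin_cases i
    · simp; linarith
    · simpa using g1
    · simpa using g2
    · simp; linarith

theorem gaussMap_spec {S : Set ℂ} {X : ℂ → R31} (hS : IsOpen S)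
    (hX : IsSpacelikeImmersion S X) {z : ℂ} (hz : z ∈ S) :
    IsLightlikeNormal X z (gaussMap X z) :=
  Classical.epsilon_spec (existsUnique_lightlikeNormal hS hX hz).exists

/-- The second fundamental form `⟨D²X(v, w), n⟩` of `X` at `z`. -/
def secondForm (X : ℂ → R31) (z v w : ℂ) : ℝ :=
  mink (fderiv ℝ (fderiv ℝ X) z v w) (gaussMap X z)

/-- The mean curvature: half the trace of the second fundamental form with respect to the
first one, in the coordinates `z = u + i v`. -/
def meanCurvature (X : ℂ → R31) (z : ℂ) : ℝ :=
  (firstForm X z 1 1 * secondForm X z Complex.I Complex.I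
    - 2 * firstForm X z 1 Complex.I * secondForm X z 1 Complex.I
    + firstForm X z Complex.I Complex.I * secondForm X z 1 1) /
  (2 * (firstForm X z 1 1 * firstForm X z Complex.I Complex.I - firstForm X z 1 Complex.I ^ 2))

/-- `v` is a principal direction of `X` at `z`. -/
def IsPrincipalDirection (X : ℂ → R31) (z v : ℂ) : Prop :=
  v ≠ 0 ∧ ∃ k : ℝ, ∀ w : ℂ, secondForm X z v w = k * firstForm X z v w

/-- `z` is an umbilic of `X`. -/
def IsUmbilic (X : ℂ → R31) (z : ℂ) : Prop :=
  ∃ k : ℝ, ∀ v w : ℂ, secondForm X z v w = k * firstForm X z v w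

/-- `γ`, restricted to the interval `(a, b)`, is a curvature line of `X` on `S`: a smooth curve
in the set of non-umbilic points whose tangent is everywhere a principal direction
(in particular, a regular curve). -/
def IsCurvatureLine (S : Set ℂ) (X : ℂ → R31) (γ : ℝ → ℂ) (a b : ℝ) : Prop :=
  ContDiffOn ℝ ∞ γ (Set.Ioo a b) ∧
  ∀ t ∈ Set.Ioo a b, γ t ∈ S ∧ ¬ IsUmbilic X (γ t) ∧ IsPrincipalDirection X (γ t) (deriv γ t)

/-- Every curvature line of `X` lies in an affine plane of isotropic 3-space. -/
def HasPlanarCurvatureLines (S : Set ℂ) (X : ℂ → R31) : Prop :=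
  ∀ (γ : ℝ → ℂ) (a b : ℝ), IsCurvatureLine S X γ a b →
    ∃ P : AffineSubspace ℝ R31, (P : Set R31) ⊆ isotropicSpace ∧
      Module.finrank ℝ P.direction = 2 ∧ ∀ t ∈ Set.Ioo a b, X (γ t) ∈ P

/-! ### Weierstrass data -/

/-- The surface `X(z) = Re ∫₀^z (h, 1, -i) η dζ` with Weierstrass data `(h, η dz)`; the integral
is taken along the segment from `0` to `z`. It is used for `η` and `h η` that extend to entire
functions, where the path does not matter and the poles of `h` are removable for `h η`. -/
def weierstrassSurface (h η : ℂ → ℂ) (z : ℂ) : R31 :=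
  ofCoords
    (∫ t in (0 : ℝ)..1, h (t * z) * η (t * z) * z).re
    (∫ t in (0 : ℝ)..1, η (t * z) * z).re
    (∫ t in (0 : ℝ)..1, -Complex.I * η (t * z) * z).re

/-- Up to isometries and homotheties of isotropic 3-space, `X` on `S` is a piece of the surface
with Weierstrass data `(h, η dz)`: it is a similarity composed with a reparametrization
of the latter by a smooth local diffeomorphism. -/
def IsPieceOf (S : Set ℂ) (X : ℂ → R31) (h η : ℂ → ℂ) : Prop :=
  ∃ (Φ : R31 → R31) (ψ : ℂ → ℂ), IsSimilarity Φ ∧ ContDiffOn ℝ ∞ ψ S ∧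
    (∀ z ∈ S, Function.Injective (fderiv ℝ ψ z)) ∧
    ∀ z ∈ S, X z = Φ (weierstrassSurface h η (ψ z))

/-- The five kinds of surfaces in the classification. -/
inductive SurfaceKind
  | plane
  | trivialEnneper
  | catenoid
  | enneper
  | bonnet

/-- `X` on `S` is, up to isometries and homotheties, a piece of a surface of the given kind. -/
def IsPieceOfKind (S : Set ℂ) (X : ℂ → R31) : SurfaceKind → Prop
  | .plane => IsPieceOf S X (fun _ => 0) (fun _ => 1)
  | .trivialEnneper => IsPieceOf S X (fun z => z) (fun _ => 1)
  | .catenoid => IsPieceOf S X (fun z => Complex.exp z) (fun z => Complex.exp (-z))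
  | .enneper => IsPieceOf S X (fun z => 1 / z) (fun z => z ^ 2)
  | .bonnet => ∃ α β : ℝ, 0 < α ∧ 0 < β ∧
      IsPieceOf S X
        (fun z => (α / β) * (Complex.cosh (α * z / 2) / Complex.sinh (α * z / 2)))
        (fun z => (2 * β / α ^ 2) * Complex.sinh (α * z / 2) ^ 2)

end

end IsotropicZMC

/-! Write `l` for the degenerate coordinate and `w = x + i y`. Spacelikeness makes `w` a local
coordinate on `S`, and the lightlike Gauss map becomes a complex function `g` with `dl = Re (g dw)`.
Then `I = |dw|²` and `II(u, v) = Re (dg(u) dw(v))`; symmetry of `II` together with `H = 0` are the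
Cauchy-Riemann equations of `g` with respect to `w`. Thus `dg = p dw` with `p` holomorphic in `w`,
`II = Re (p dw²)`, and umbilics are the zeros of `p`.

Near a non-umbilic point choose `ζ` with `p dw² = dζ²`; the lines `Im ζ = const` are curvature
lines. With `η = dw/dζ` one has `dg/dζ = 1/η`. If such a line lies in the plane `A l + Re (β w) =
d`, then `Re ((A g + β) η) = 0` along it; two more derivatives eliminate `A` and `β` and leave `Im
(q' + q²/2) = 0` for `q = η'/η` (`im_eq_zero_of_planar`). So `q' + q²/2` is a real constant, and
integration gives `1/η = Q(g)` with `Q` a polynomial of degree at most two and real discriminant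
(`exists_quadratic_of_im_eq_zero`). Hence `p = Q(g)²`. This spreads over `S` by the identity
theorem, and `Q(g)` never vanishes because it solves a linear equation (`exists_quadratic`).

The equation `dg = Q(g)² dw` is then solved according to the roots of `Q`: constant, linear, double
root and two simple roots give the trivial Enneper-type surface, catenoid, Enneper-type and
Bonnet-type surfaces; `p = 0` gives the plane (`exists_isPieceOfKind`). A real discriminant is what
makes the scaling factor real for the catenoid and Bonnet types.

For uniqueness, a similarity changes `g` by an affine map, so each kind forces `p = P(g)` with a
characteristic degree and root pattern of `P`; since `g` is non-constant unless the surface is a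
plane, `P` is determined by `X` (`IsPieceOfKind.unique`). -/

namespace IsotropicZMC

noncomputable section

open Complex Metric Filter Topology Polynomial

section

/-! ### Functions that are holomorphic with respect to a local coordinate -/

/-- `w` is smooth on `S`, with invertible differential: a local coordinate on `S`. -/
structure IsLocalCoord (S : Set ℂ) (w : ℂ → ℂ) : Prop where
  isOpen : IsOpen S
  smooth : ContDiffOn ℝ ∞ w S
  injective : ∀ z ∈ S, Function.Injective (fderiv ℝ w z)

/-- `df = f' dw` on `S`. -/
def HasCoordDeriv (S : Set ℂ) (w f f' : ℂ → ℂ) : Prop :=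
  ∀ z ∈ S, HasFDerivAt f (f' z • fderiv ℝ w z : ℂ →L[ℝ] ℂ) z

/-- `f` is holomorphic on `S` with respect to the local coordinate `w`. -/
def IsCoordHolo (S : Set ℂ) (w f : ℂ → ℂ) : Prop := ∃ f', HasCoordDeriv S w f f'

variable {S : Set ℂ} {w f f' k k' : ℂ → ℂ}

theorem HasCoordDeriv.isCoordHolo (h : HasCoordDeriv S w f f') : IsCoordHolo S w f := ⟨f', h⟩

theorem HasCoordDeriv.comp_hasDerivAt (hf : HasCoordDeriv S w f f') {φ φ' : ℂ → ℂ}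
    (hφ : ∀ z ∈ S, HasDerivAt φ (φ' (f z)) (f z)) :
    HasCoordDeriv S w (fun z => φ (f z)) (fun z => φ' (f z) * f' z) := by
  intro z hz
  have h1 := (hφ z hz).hasFDerivAt.restrictScalars ℝ
  refine (h1.comp z (hf z hz)).congr_fderiv ?_
  ext v
  simp only [ContinuousLinearMap.comp_apply, _root_.smul_apply, smul_eq_mul,
    ContinuousLinearMap.coe_restrictScalars', ContinuousLinearMap.toSpanSingleton_apply]
  ring

theorem HasCoordDeriv.sub (hf : HasCoordDeriv S w f f') (hk : HasCoordDeriv S w k k') :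
    HasCoordDeriv S w (fun z => f z - k z) (fun z => f' z - k' z) := fun z hz =>
  ((hf z hz).sub (hk z hz)).congr_fderiv (by rw [sub_smul])

theorem HasCoordDeriv.mul (hf : HasCoordDeriv S w f f') (hk : HasCoordDeriv S w k k') :
    HasCoordDeriv S w (fun z => f z * k z) (fun z => f z * k' z + k z * f' z) := fun z hz =>
  ((hf z hz).mul (hk z hz)).congr_fderiv (by
    ext v
    simp [smul_eq_mul]
    ring)

theorem HasCoordDeriv.congr_deriv (hf : HasCoordDeriv S w f f') (h : ∀ z ∈ S, f' z = k' z) :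
    HasCoordDeriv S w f k' := fun z hz => by rw [← h z hz]; exact hf z hz

theorem IsCoordHolo.sub (hf : IsCoordHolo S w f) (hk : IsCoordHolo S w k) :
    IsCoordHolo S w (fun z => f z - k z) :=
  ⟨_, hf.choose_spec.sub hk.choose_spec⟩

theorem IsCoordHolo.mul (hf : IsCoordHolo S w f) (hk : IsCoordHolo S w k) :
    IsCoordHolo S w (fun z => f z * k z) :=
  ⟨_, hf.choose_spec.mul hk.choose_spec⟩

theorem IsCoordHolo.comp_differentiable (hf : IsCoordHolo S w f) {φ : ℂ → ℂ}
    (hφ : Differentiable ℂ φ) : IsCoordHolo S w (fun z => φ (f z)) :=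
  ⟨_, hf.choose_spec.comp_hasDerivAt (φ' := deriv φ) fun z _ => (hφ (f z)).hasDerivAt⟩

theorem IsLocalCoord.hasCoordDeriv_self (hw : IsLocalCoord S w) :
    HasCoordDeriv S w w (fun _ => 1) := fun z hz => by
  rw [one_smul]
  exact ((hw.smooth.contDiffAt (hw.isOpen.mem_nhds hz)).differentiableAt (by simp)).hasFDerivAt

theorem IsLocalCoord.fderiv_one_ne_zero (hw : IsLocalCoord S w) {z : ℂ} (hz : z ∈ S) :
    fderiv ℝ w z 1 ≠ 0 := fun h =>
  one_ne_zero (hw.injective z hz (h.trans (map_zero _).symm))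

/-- A smooth local section of a local coordinate. -/
structure IsLocalSection (S : Set ℂ) (w : ℂ → ℂ) (z₀ : ℂ) (σ : ℂ → ℂ) (ε : ℝ) : Prop where
  pos : 0 < ε
  center : σ (w z₀) = z₀
  mem : ∀ ξ ∈ ball (w z₀) ε, σ ξ ∈ S
  right_inv : ∀ ξ ∈ ball (w z₀) ε, w (σ ξ) = ξ
  smooth : ∀ ξ ∈ ball (w z₀) ε, ContDiffAt ℝ ∞ σ ξ
  left_inv : ∀ᶠ z in 𝓝 z₀, w z ∈ ball (w z₀) ε ∧ σ (w z) = z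

/-- Inverse function theorem. Composition with such a section turns functions holomorphic in `w`
into ordinary holomorphic functions on a disc, where the theorems of complex analysis apply. -/
theorem IsLocalCoord.exists_isLocalSection (hw : IsLocalCoord S w) {z₀ : ℂ} (hz₀ : z₀ ∈ S) :
    ∃ σ ε, IsLocalSection S w z₀ σ ε := by
  have hsm : ∀ z ∈ S, ContDiffAt ℝ ∞ w z := fun z hz =>
    hw.smooth.contDiffAt (hw.isOpen.mem_nhds hz)
  let E : ∀ z ∈ S, ℂ ≃L[ℝ] ℂ := fun z hz =>
    (LinearEquiv.ofInjectiveEndo (fderiv ℝ w z : ℂ →ₗ[ℝ] ℂ)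
      (hw.injective z hz)).toContinuousLinearEquiv
  have hE : ∀ z (hz : z ∈ S), HasFDerivAt w (E z hz : ℂ →L[ℝ] ℂ) z := by
    intro z hz
    have := ((hsm z hz).differentiableAt (by simp)).hasFDerivAt
    convert! this
  let e := (hsm z₀ hz₀).toOpenPartialHomeomorph w (hE z₀ hz₀) (by simp)
  have hes : z₀ ∈ e.source := ContDiffAt.mem_toOpenPartialHomeomorph_source _ _ _
  have het : w z₀ ∈ e.target := ContDiffAt.image_mem_toOpenPartialHomeomorph_target _ _ _
  have hc : e.symm (w z₀) = z₀ := e.left_inv hes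
  have hopen : IsOpen (e.target ∩ e.symm ⁻¹' S) :=
    e.symm.isOpen_inter_preimage hw.isOpen
  obtain ⟨ε, hε, hball⟩ := Metric.isOpen_iff.1 hopen (w z₀) ⟨het, by
    rw [Set.mem_preimage, hc]; exact hz₀⟩
  refine ⟨e.symm, ε, hε, hc, fun ξ hξ => (hball hξ).2, fun ξ hξ => e.right_inv (hball hξ).1,
    fun ξ hξ => ?_, ?_⟩
  · exact e.contDiffAt_symm (hball hξ).1 (hE _ (hball hξ).2) (hsm _ (hball hξ).2)
  · have h1 : ∀ᶠ z in 𝓝 z₀, w z ∈ ball (w z₀) ε :=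
      (hsm z₀ hz₀).continuousAt.eventually (ball_mem_nhds _ hε)
    filter_upwards [h1, e.open_source.mem_nhds hes] with z hz1 hz2
    exact ⟨hz1, e.left_inv hz2⟩

variable {z₀ : ℂ} {σ : ℂ → ℂ} {ε : ℝ}

theorem IsLocalSection.fderiv_comp (hσ : IsLocalSection S w z₀ σ ε) (hw : IsLocalCoord S w)
    {ξ : ℂ} (hξ : ξ ∈ ball (w z₀) ε) (v : ℂ) :
    fderiv ℝ w (σ ξ) (fderiv ℝ σ ξ v) = v := by
  have h1 : HasFDerivAt σ (fderiv ℝ σ ξ) ξ :=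
    ((hσ.smooth ξ hξ).differentiableAt (by simp)).hasFDerivAt
  have h2 := (hw.hasCoordDeriv_self (σ ξ) (hσ.mem ξ hξ)).comp ξ h1
  have h3 : w ∘ σ =ᶠ[𝓝 ξ] id := by
    filter_upwards [isOpen_ball.mem_nhds hξ] with x hx using hσ.right_inv x hx
  have h4 := (h2.congr_of_eventuallyEq h3.symm).unique (hasFDerivAt_id ξ)
  simpa using congrArg (fun L : ℂ →L[ℝ] ℂ => L v) h4

theorem IsLocalSection.hasDerivAt_comp (hσ : IsLocalSection S w z₀ σ ε) (hw : IsLocalCoord S w)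
    (hf : HasCoordDeriv S w f f') {ξ : ℂ} (hξ : ξ ∈ ball (w z₀) ε) :
    HasDerivAt (fun x => f (σ x)) (f' (σ ξ)) ξ := by
  have h1 : HasFDerivAt σ (fderiv ℝ σ ξ) ξ :=
    ((hσ.smooth ξ hξ).differentiableAt (by simp)).hasFDerivAt
  have h2 := (hf (σ ξ) (hσ.mem ξ hξ)).comp ξ h1
  rw [hasDerivAt_iff_hasFDerivAt]
  refine hasFDerivAt_of_restrictScalars ℝ h2 ?_
  ext v
  simp [hσ.fderiv_comp hw hξ, mul_comm]

theorem IsLocalSection.differentiableOn_comp (hσ : IsLocalSection S w z₀ σ ε)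
    (hw : IsLocalCoord S w) (hf : IsCoordHolo S w f) :
    DifferentiableOn ℂ (fun x => f (σ x)) (ball (w z₀) ε) := fun _ hξ =>
  (hσ.hasDerivAt_comp hw hf.choose_spec hξ).differentiableAt.differentiableWithinAt

theorem IsLocalSection.center_mem (hσ : IsLocalSection S w z₀ σ ε) : w z₀ ∈ ball (w z₀) ε :=
  mem_ball_self hσ.pos

/-- The derivative of a holomorphic function with respect to a coordinate is holomorphic. -/
theorem HasCoordDeriv.isCoordHolo_deriv (hf : HasCoordDeriv S w f f') (hw : IsLocalCoord S w) :
    IsCoordHolo S w f' := by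
  have : ∀ z ∈ S, ∃ c : ℂ, HasFDerivAt f' (c • fderiv ℝ w z : ℂ →L[ℝ] ℂ) z := by
    intro z hz
    obtain ⟨σ, ε, hσ⟩ := hw.exists_isLocalSection hz
    have h1 : DifferentiableOn ℂ (fun x => f' (σ x)) (ball (w z) ε) :=
      (hσ.differentiableOn_comp hw hf.isCoordHolo).deriv isOpen_ball |>.congr fun ξ hξ =>
        (hσ.hasDerivAt_comp hw hf hξ).deriv.symm
    have h2 := (h1.differentiableAt (isOpen_ball.mem_nhds hσ.center_mem)).hasDerivAt
    refine ⟨deriv (fun x => f' (σ x)) (w z),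
      HasFDerivAt.congr_of_eventuallyEq (f := fun y => f' (σ (w y))) ?_ ?_⟩
    · refine ((h2.hasFDerivAt.restrictScalars ℝ).comp z
        (hw.hasCoordDeriv_self z hz)).congr_fderiv ?_
      ext v
      simp [mul_comm]
    · filter_upwards [hσ.left_inv] with y hy
      rw [hy.2]
  choose! c hc using this
  exact ⟨c, hc⟩

theorem IsCoordHolo.contDiffOn (hf : IsCoordHolo S w f) (hw : IsLocalCoord S w) :
    ContDiffOn ℝ ∞ f S := by
  intro z hz
  obtain ⟨σ, ε, hσ⟩ := hw.exists_isLocalSection hz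
  have h1 : ContDiffAt ℂ ∞ (fun x => f (σ x)) (w z) :=
    ((hσ.differentiableOn_comp hw hf).contDiffOn isOpen_ball).contDiffAt
      (isOpen_ball.mem_nhds hσ.center_mem)
  have h2 := (h1.restrict_scalars ℝ).comp z (hw.smooth.contDiffAt (hw.isOpen.mem_nhds hz))
  refine (h2.congr_of_eventuallyEq ?_).contDiffWithinAt
  filter_upwards [hσ.left_inv] with y hy
  simp [hy.2]

/-- Identity theorem. -/
theorem IsCoordHolo.eqOn_zero (hf : IsCoordHolo S w f) (hw : IsLocalCoord S w)
    (hS : IsPreconnected S) (hz₀ : z₀ ∈ S) (h0 : ∀ᶠ z in 𝓝 z₀, f z = 0) :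
    ∀ z ∈ S, f z = 0 := by
  -- The set of points near which `f` vanishes is open, and relatively closed in `S` by the identity
  -- theorem on discs; connectedness does the rest.
  have key : S ⊆ {z | ∀ᶠ y in 𝓝 z, f y = 0} := by
    refine hS.subset_of_closure_inter_subset isOpen_setOfPred_eventually_nhds ⟨z₀, hz₀, h0⟩ ?_
    rintro z₁ ⟨hcl, hz₁⟩
    obtain ⟨σ, ε, hσ⟩ := hw.exists_isLocalSection hz₁
    have han : AnalyticOnNhd ℂ (fun x => f (σ x)) (ball (w z₁) ε) :=
      (hσ.differentiableOn_comp hw hf).analyticOnNhd isOpen_ball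
    obtain ⟨y, hy1, hy2⟩ := mem_closure_iff_nhds.1 hcl _ hσ.left_inv
    have hev : (fun x => f (σ x)) =ᶠ[𝓝 (w y)] 0 := by
      have hc : Tendsto σ (𝓝 (w y)) (𝓝 y) := by
        have := (hσ.smooth _ hy1.1).continuousAt.tendsto
        rwa [hy1.2] at this
      exact hc.eventually hy2
    have hz := han.eqOn_zero_of_preconnected_of_eventuallyEq_zero
      (convex_ball _ _).isPreconnected hy1.1 hev
    change ∀ᶠ y in 𝓝 z₁, f y = 0
    filter_upwards [hσ.left_inv] with x hx
    have := hz hx.1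
    simpa [hx.2] using this
  exact fun z hz => (key hz).self_of_nhds

/-- A solution of `df = (k f) dw` with a zero vanishes. -/
theorem HasCoordDeriv.eq_zero_of_linear (hf : HasCoordDeriv S w f (fun z => k z * f z))
    (hk : IsCoordHolo S w k) (hw : IsLocalCoord S w) (hS : IsPreconnected S)
    (hz₀ : z₀ ∈ S) (h0 : f z₀ = 0) : ∀ z ∈ S, f z = 0 := by
  refine hf.isCoordHolo.eqOn_zero hw hS hz₀ ?_
  obtain ⟨σ, ε, hσ⟩ := hw.exists_isLocalSection hz₀
  obtain ⟨K, hK⟩ := (hσ.differentiableOn_comp hw hk).isExactOn_ball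
  -- Integrating factor: `K` is a primitive of `k` on the disc.
  have hd : ∀ ξ ∈ ball (w z₀) ε, HasDerivAt (fun x => f (σ x) * exp (-K x)) 0 ξ := by
    intro ξ hξ
    refine ((hσ.hasDerivAt_comp hw hf hξ).mul (hK ξ hξ).neg.cexp).congr_deriv ?_
    ring
  have hconst : ∀ ξ ∈ ball (w z₀) ε, f (σ ξ) * exp (-K ξ) = 0 := by
    intro ξ hξ
    rw [isOpen_ball.is_const_of_deriv_eq_zero (convex_ball _ _).isPreconnected
      (fun x hx => (hd x hx).differentiableAt.differentiableWithinAt)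
      (fun x hx => (hd x hx).deriv) hξ hσ.center_mem, hσ.center, h0, zero_mul]
  filter_upwards [hσ.left_inv] with y hy
  have := hconst _ hy.1
  rw [hy.2] at this
  exact (mul_eq_zero.1 this).resolve_right (exp_ne_zero _)

/-- Two functions with the same differential on a connected set, equal at one point, are equal. -/
theorem HasCoordDeriv.eqOn (hf : HasCoordDeriv S w f f') (hk : HasCoordDeriv S w k f')
    (hw : IsLocalCoord S w) (hS : IsPreconnected S) (hz₀ : z₀ ∈ S) (h0 : f z₀ = k z₀) :
    ∀ z ∈ S, f z = k z := fun _ hz =>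
  hw.isOpen.eqOn_of_fderiv_eq hS
    (fun x hx => (hf x hx).differentiableAt.differentiableWithinAt)
    (fun x hx => (hk x hx).differentiableAt.differentiableWithinAt)
    (fun x hx => (hf x hx).fderiv.trans (hk x hx).fderiv.symm) hz₀ h0 hz

end

section

/-! ### The complex data of a spacelike surface -/

/-- The spacelike coordinate `x + i y` of a surface in isotropic 3-space. -/
def planeCoord (X : ℂ → R31) (z : ℂ) : ℂ := X z 1 + X z 2 * I

/-- The Gauss map as a complex function: for the graph of `Re F` it is `F'`. -/
def gaussCoord (X : ℂ → R31) (z : ℂ) : ℂ := -(gaussMap X z 1) + gaussMap X z 2 * I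


/-- The linear map `(x₀, x₁, x₂, x₃) ↦ x₁ + i x₂`. -/
def planeProj : R31 →L[ℝ] ℂ :=
  ofRealCLM.comp (ContinuousLinearMap.proj 1) + (I • ofRealCLM).comp (ContinuousLinearMap.proj 2)

@[simp]
theorem planeProj_apply (x : R31) : planeProj x = x 1 + x 2 * I := by
  simp [planeProj, mul_comm]

theorem mem_isotropicSpace {x : R31} : x ∈ isotropicSpace ↔ x 3 = x 0 := by
  change mink x pVec = 0 ↔ _
  simp only [mink, pVec]
  simp
  constructor <;> intro h <;> linarith

variable {S : Set ℂ} {X : ℂ → R31}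

theorem IsSpacelikeImmersion.contDiffAt (hX : IsSpacelikeImmersion S X) (hS : IsOpen S) {z : ℂ}
    (hz : z ∈ S) : ContDiffAt ℝ ∞ X z := hX.smooth.contDiffAt (hS.mem_nhds hz)

theorem IsSpacelikeImmersion.hasFDerivAt (hX : IsSpacelikeImmersion S X) (hS : IsOpen S) {z : ℂ}
    (hz : z ∈ S) : HasFDerivAt X (fderiv ℝ X z) z :=
  ((hX.contDiffAt hS hz).differentiableAt (by simp)).hasFDerivAt

theorem IsSpacelikeImmersion.fderiv_planeCoord (hX : IsSpacelikeImmersion S X) (hS : IsOpen S)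
    {z : ℂ} (hz : z ∈ S) : fderiv ℝ (planeCoord X) z = planeProj.comp (fderiv ℝ X z) := by
  have := planeProj.hasFDerivAt.comp z (hX.hasFDerivAt hS hz)
  refine HasFDerivAt.fderiv ?_
  convert! this using 1
  ext y
  simp [planeCoord]

theorem IsSpacelikeImmersion.firstForm_eq (hX : IsSpacelikeImmersion S X) (hS : IsOpen S)
    {z : ℂ} (hz : z ∈ S) (u v : ℂ) : firstForm X z u v =
      (fderiv ℝ (planeCoord X) z u * (starRingEnd ℂ) (fderiv ℝ (planeCoord X) z v)).re := by
  rw [hX.fderiv_planeCoord hS hz]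
  have h1 := mem_isotropicSpace.1 (fderiv_mem_isotropicSpace hS hX hz u)
  have h2 := mem_isotropicSpace.1 (fderiv_mem_isotropicSpace hS hX hz v)
  simp [firstForm, mink, h1, h2]
  ring

theorem IsSpacelikeImmersion.isLocalCoord (hX : IsSpacelikeImmersion S X) (hS : IsOpen S) :
    IsLocalCoord S (planeCoord X) where
  isOpen := hS
  smooth := by
    have := planeProj.contDiff.comp_contDiffOn (n := ∞) hX.smooth
    convert! this using 1
    ext y
    simp [planeCoord]
  injective := by
    intro z hz
    refine (injective_iff_map_eq_zero _).2 fun v hv => ?_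
    by_contra h
    have := hX.spacelike z hz v h
    rw [hX.firstForm_eq hS hz, hv] at this
    simp at this

/-- This is `dl = Re (g dw)`, obtained by expanding `⟨dX, n⟩ = 0` with `⟨n, 𝔭⟩ = 1`. It fixes the
signs in `gaussCoord`. -/
theorem IsSpacelikeImmersion.fderiv_zero (hX : IsSpacelikeImmersion S X) (hS : IsOpen S)
    {z : ℂ} (hz : z ∈ S) (v : ℂ) :
    fderiv ℝ X z v 0 = (gaussCoord X z * fderiv ℝ (planeCoord X) z v).re := by
  obtain ⟨-, h2, h3⟩ := gaussMap_spec hS hX hz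
  have h1 := mem_isotropicSpace.1 (fderiv_mem_isotropicSpace hS hX hz v)
  have h2 := h2 v
  rw [hX.fderiv_planeCoord hS hz]
  simp only [mink, pVec] at h2 h3
  simp [gaussCoord] at *
  rw [h1] at h2
  linear_combination h2 - fderiv ℝ X z v 0 * h3

/-- The quantity is the determinant of `L` as a real `2 × 2` matrix. If it vanished, `L I * conj (L
1)` would be real, so a real combination of `1` and `I` with coefficient `-|L 1|²` on `I` would lie
in the kernel. -/
theorem conj_mul_im_ne_zero_of_injective {L : ℂ →L[ℝ] ℂ} (hL : Function.Injective L) :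
    ((starRingEnd ℂ) (L 1) * L I).im ≠ 0 := by
  intro h
  have h1 : L (((L I * (starRingEnd ℂ) (L 1)).re : ℝ) - ((normSq (L 1) : ℝ) : ℂ) * I) = 0 := by
    have e : (((L I * (starRingEnd ℂ) (L 1)).re : ℝ) - ((normSq (L 1) : ℝ) : ℂ) * I) =
        ((L I * (starRingEnd ℂ) (L 1)).re) • (1 : ℂ) - (normSq (L 1)) • I := by
      simp
    rw [e, map_sub, map_smul, map_smul]
    apply Complex.ext
    · simp [normSq_apply] at *
      linear_combination (L 1).im * h
    · simp [normSq_apply] at *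
      linear_combination -(L 1).re * h
  have h2 := hL (h1.trans (map_zero L).symm)
  have h3 : L 1 = 0 := by
    have := congrArg Complex.im h2
    simpa using this
  exact one_ne_zero (hL (h3.trans (map_zero L).symm))

/-- Explicit formula for the Gauss map. -/
theorem IsSpacelikeImmersion.gaussCoord_eq (hX : IsSpacelikeImmersion S X) (hS : IsOpen S)
    {z : ℂ} (hz : z ∈ S) : gaussCoord X z =
      (I * ((fderiv ℝ X z 1 0 : ℝ) * (starRingEnd ℂ) (planeProj (fderiv ℝ X z I)) -
        (fderiv ℝ X z I 0 : ℝ) * (starRingEnd ℂ) (planeProj (fderiv ℝ X z 1)))) /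
      (((starRingEnd ℂ) (planeProj (fderiv ℝ X z 1)) * planeProj (fderiv ℝ X z I)).im : ℝ) := by
  have hJ := conj_mul_im_ne_zero_of_injective ((hX.isLocalCoord hS).injective z hz)
  rw [hX.fderiv_zero hS hz, hX.fderiv_zero hS hz]
  rw [hX.fderiv_planeCoord hS hz] at *
  simp only [ContinuousLinearMap.comp_apply] at *
  generalize planeProj (fderiv ℝ X z 1) = a at *
  generalize planeProj (fderiv ℝ X z I) = b at *
  rw [eq_div_iff (by exact_mod_cast hJ)]
  apply Complex.ext <;> simp <;> ring

/-- The Gauss map is defined pointwise by choice, so its smoothness has to be read off from the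
explicit formula, whose denominator is the Jacobian of `w`. -/
theorem IsSpacelikeImmersion.contDiffOn_gaussCoord (hX : IsSpacelikeImmersion S X)
    (hS : IsOpen S) : ContDiffOn ℝ ∞ (gaussCoord X) S := by
  have hd : ∀ v, ContDiffOn ℝ ∞ (fun z => fderiv ℝ X z v) S := fun v =>
    (hX.smooth.fderiv_of_isOpen hS (by simp)).clm_apply contDiffOn_const
  have hp : ∀ v, ContDiffOn ℝ ∞ (fun z => planeProj (fderiv ℝ X z v)) S := fun v =>
    planeProj.contDiff.comp_contDiffOn (hd v)
  have hc : ∀ v, ContDiffOn ℝ ∞ (fun z => (starRingEnd ℂ) (planeProj (fderiv ℝ X z v))) S :=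
    fun v => conjCLE.contDiff.comp_contDiffOn (hp v)
  have hl : ∀ v, ContDiffOn ℝ ∞ (fun z => ((fderiv ℝ X z v 0 : ℝ) : ℂ)) S := fun v =>
    (ofRealCLM.comp (ContinuousLinearMap.proj (R := ℝ) (φ := fun _ : Fin 4 => ℝ)
      0)).contDiff.comp_contDiffOn (hd v)
  refine ContDiffOn.congr ?_ fun z hz => hX.gaussCoord_eq hS hz
  have hJ : ContDiffOn ℝ ∞ (fun z => ((((starRingEnd ℂ) (planeProj (fderiv ℝ X z 1)) *
      planeProj (fderiv ℝ X z I)).im : ℝ) : ℂ)) S :=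
    (ofRealCLM.comp imCLM).contDiff.comp_contDiffOn ((hc 1).mul (hp I))
  simp only [div_eq_mul_inv]
  refine (contDiffOn_const.mul (((hl 1).mul (hc I)).sub ((hl I).mul (hc 1)))).mul (hJ.inv ?_)
  intro z hz
  have := conj_mul_im_ne_zero_of_injective ((hX.isLocalCoord hS).injective z hz)
  rw [hX.fderiv_planeCoord hS hz] at this
  exact_mod_cast this

theorem IsSpacelikeImmersion.hasFDerivAt_gaussCoord (hX : IsSpacelikeImmersion S X)
    (hS : IsOpen S) {z : ℂ} (hz : z ∈ S) :
    HasFDerivAt (gaussCoord X) (fderiv ℝ (gaussCoord X) z) z :=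
  (((hX.contDiffOn_gaussCoord hS).contDiffAt (hS.mem_nhds hz)).differentiableAt
    (by simp)).hasFDerivAt

/-- Differentiate `dl = Re (g dw)`: the terms with second derivatives of `w` are exactly those that
pairing `D²X` with `n` cancels, leaving `Re (dg dw)`. -/
theorem IsSpacelikeImmersion.secondForm_eq (hX : IsSpacelikeImmersion S X) (hS : IsOpen S)
    {z : ℂ} (hz : z ∈ S) (u v : ℂ) : secondForm X z u v =
      (fderiv ℝ (gaussCoord X) z u * fderiv ℝ (planeCoord X) z v).re := by
  have hD : HasFDerivAt (fun y => fderiv ℝ X y v)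
      ((ContinuousLinearMap.apply ℝ R31 v).comp (fderiv ℝ (fderiv ℝ X) z)) z := by
    refine (ContinuousLinearMap.apply ℝ R31 v).hasFDerivAt.comp z ?_
    exact ((((hX.contDiffAt hS hz).fderiv_right (m := ∞)
      (by simp)).differentiableAt (by simp))).hasFDerivAt
  have hD' := hasFDerivAt_pi'.1 hD
  have hp := planeProj.hasFDerivAt.comp z hD
  have hprod := reCLM.hasFDerivAt.comp z ((hX.hasFDerivAt_gaussCoord hS hz).mul hp)
  have e0 : (fun y => fderiv ℝ X y v 0) =ᶠ[𝓝 z] (reCLM ∘ fun y => gaussCoord X y *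
      (planeProj ∘ fun y => fderiv ℝ X y v) y) := by
    filter_upwards [hS.mem_nhds hz] with y hy
    rw [hX.fderiv_zero hS hy, hX.fderiv_planeCoord hS hy]
    simp
  have e3 : (fun y => fderiv ℝ X y v 3) =ᶠ[𝓝 z] (fun y => fderiv ℝ X y v 0) := by
    filter_upwards [hS.mem_nhds hz] with y hy using
      mem_isotropicSpace.1 (fderiv_mem_isotropicSpace hS hX hy v)
  have k0 := congrArg (fun L : ℂ →L[ℝ] ℝ => L u)
    ((hD' 0).unique (hprod.congr_of_eventuallyEq e0))
  have k3 := congrArg (fun L : ℂ →L[ℝ] ℝ => L u)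
    ((hD' 3).unique ((hD' 0).congr_of_eventuallyEq e3))
  obtain ⟨-, -, h3⟩ := gaussMap_spec hS hX hz
  rw [hX.fderiv_planeCoord hS hz]
  simp only [mink, pVec] at h3
  simp at k0
  simp at k3
  simp at h3
  simp only [secondForm, mink, k3]
  simp [gaussCoord] at *
  linear_combination (fderiv ℝ (fderiv ℝ X) z u v 0) * h3 + k0

theorem secondForm_comm (hX : IsSpacelikeImmersion S X) (hS : IsOpen S)
    {z : ℂ} (hz : z ∈ S) (u v : ℂ) : secondForm X z u v = secondForm X z v u := by
  have := (hX.contDiffAt hS hz).isSymmSndFDerivAt (by simp; exact ENat.LEInfty.out)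
  rw [secondForm, secondForm, this.eq u v]

/-- The Gauss map of a surface of zero mean curvature is holomorphic. -/
theorem IsSpacelikeImmersion.exists_hasCoordDeriv_gaussCoord (hX : IsSpacelikeImmersion S X)
    (hS : IsOpen S) (hH : ∀ z ∈ S, meanCurvature X z = 0) :
    ∃ p, HasCoordDeriv S (planeCoord X) (gaussCoord X) p := by
  refine ⟨fun z => fderiv ℝ (gaussCoord X) z 1 / fderiv ℝ (planeCoord X) z 1, fun z hz => ?_⟩
  have hJ := conj_mul_im_ne_zero_of_injective ((hX.isLocalCoord hS).injective z hz)
  have ha := (hX.isLocalCoord hS).fderiv_one_ne_zero hz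
  have hsymm := secondForm_comm hX hS hz 1 I
  have hmean := hH z hz
  -- The Gram determinant is the square of the Jacobian of `w`.
  have hden : 2 * (firstForm X z 1 1 * firstForm X z I I - firstForm X z 1 I ^ 2) ≠ 0 := by
    rw [hX.firstForm_eq hS hz, hX.firstForm_eq hS hz, hX.firstForm_eq hS hz]
    generalize fderiv ℝ (planeCoord X) z 1 = a at *
    generalize fderiv ℝ (planeCoord X) z I = b at *
    have : 2 * ((a * (starRingEnd ℂ) a).re * (b * (starRingEnd ℂ) b).re -
        (a * (starRingEnd ℂ) b).re ^ 2) = 2 * (((starRingEnd ℂ) a * b).im) ^ 2 := by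
      simp
      ring
    rw [this]
    positivity
  rw [meanCurvature, div_eq_zero_iff, or_iff_left hden] at hmean
  simp only [hX.secondForm_eq hS hz, hX.firstForm_eq hS hz] at hmean hsymm
  -- These are the Cauchy-Riemann equations `dg ∧ dw = 0`. The real part is the symmetry of `II`;
  -- the imaginary part, times the Jacobian, is the vanishing trace.
  have key : fderiv ℝ (gaussCoord X) z I * fderiv ℝ (planeCoord X) z 1 =
      fderiv ℝ (gaussCoord X) z 1 * fderiv ℝ (planeCoord X) z I := by
    generalize fderiv ℝ (planeCoord X) z 1 = a at *
    generalize fderiv ℝ (planeCoord X) z I = b at *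
    generalize fderiv ℝ (gaussCoord X) z 1 = A at *
    generalize fderiv ℝ (gaussCoord X) z I = B at *
    apply Complex.ext
    · linear_combination -hsymm
    · have : ((starRingEnd ℂ) a * b).im * ((A * b).im - (B * a).im) = 0 := by
        simp at hmean hsymm
        simp [-mul_eq_zero]
        linear_combination hmean + (a.re * b.re + a.im * b.im) * hsymm
      have := (mul_eq_zero.1 this).resolve_left hJ
      linarith
  refine (hX.hasFDerivAt_gaussCoord hS hz).congr_fderiv ?_
  ext v
  have hlin : ∀ L : ℂ →L[ℝ] ℂ, L v = v.re * L 1 + v.im * L I := by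
    intro L
    have : v = v.re • (1 : ℂ) + v.im • I := by simp
    conv_lhs => rw [this, map_add, map_smul, map_smul]
    simp
  rw [_root_.smul_apply, hlin, hlin (fderiv ℝ (planeCoord X) z), smul_eq_mul]
  field_simp
  linear_combination (v.im : ℂ) * key

end

section

/-! ### Isothermic curvature line coordinates -/

/-- A local coordinate `ζ` with `P dξ² = dζ²`, given by its inverse `ξ = u ζ`. -/
theorem exists_coord_quadratic_differential {P : ℂ → ℂ} {w₀ : ℂ} {ε : ℝ} (hε : 0 < ε)
    (hP : DifferentiableOn ℂ P (ball w₀ ε)) (h0 : P w₀ ≠ 0) :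
    ∃ (u η : ℂ → ℂ) (δ : ℝ), 0 < δ ∧
      (∀ ζ ∈ ball (0 : ℂ) δ, u ζ ∈ ball w₀ ε ∧ HasDerivAt u (η ζ) ζ ∧ P (u ζ) * η ζ ^ 2 = 1) ∧
      ∀ᶠ ξ in 𝓝 w₀, ∃ ζ ∈ ball (0 : ℂ) δ, u ζ = ξ := by
  have hPa : ContinuousAt P w₀ :=
    (hP.differentiableAt (isOpen_ball.mem_nhds (mem_ball_self hε))).continuousAt
  have hslit : ∀ᶠ ξ in 𝓝 w₀, P ξ / P w₀ ∈ slitPlane := by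
    refine (hPa.div_const (P w₀)).eventually (isOpen_slitPlane.mem_nhds ?_)
    simp only [div_self h0]
    exact one_mem_slitPlane
  obtain ⟨ε', hε', hV⟩ := Metric.eventually_nhds_iff_ball.1
    (hslit.and (isOpen_ball.mem_nhds (mem_ball_self hε)))
  obtain ⟨r₀, hr₀⟩ := IsAlgClosed.exists_pow_nat_eq (P w₀) (n := 2) (by norm_num)
  -- A holomorphic branch of `√P` near `w₀`. Its primitive `Z` is the coordinate `ζ`, and `u` is the
  -- local inverse of `Z`.
  set R : ℂ → ℂ := fun ξ => r₀ * exp (log (P ξ / P w₀) / 2) with hR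
  have hR2 : ∀ ξ ∈ ball w₀ ε', R ξ ^ 2 = P ξ := by
    intro ξ hξ
    have h1 : P ξ / P w₀ ≠ 0 := slitPlane_ne_zero (hV ξ hξ).1
    simp only [hR]
    rw [mul_pow, hr₀, ← exp_nat_mul]
    have : ((2 : ℕ) : ℂ) * (log (P ξ / P w₀) / 2) = log (P ξ / P w₀) := by push_cast; ring
    rw [this, exp_log h1]
    field_simp
  have hRne : ∀ ξ ∈ ball w₀ ε', R ξ ≠ 0 := by
    intro ξ hξ h
    have h1 := hR2 ξ hξ
    have h2 : P ξ / P w₀ ≠ 0 := slitPlane_ne_zero (hV ξ hξ).1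
    rw [h] at h1
    apply h2
    rw [← h1]
    simp
  have hRd : DifferentiableOn ℂ R (ball w₀ ε') := by
    intro ξ hξ
    have h1 : DifferentiableAt ℂ P ξ := hP.differentiableAt (isOpen_ball.mem_nhds (hV ξ hξ).2)
    exact ((((h1.div_const _).clog (hV ξ hξ).1).div_const _).cexp.const_mul
      r₀).differentiableWithinAt
  obtain ⟨Z, hZ0, hZ⟩ := hRd.isExactOn_ball.with_val_at w₀ 0
  have hw₀ : w₀ ∈ ball w₀ ε' := mem_ball_self hε'
  have hZs : HasStrictDerivAt Z (R w₀) w₀ := by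
    have hZd : DifferentiableOn ℂ Z (ball w₀ ε') := fun x hx =>
      (hZ x hx).differentiableAt.differentiableWithinAt
    have := (hZd.analyticAt (isOpen_ball.mem_nhds hw₀)).hasStrictDerivAt
    rwa [(hZ w₀ hw₀).deriv] at this
  let e := (hZs.hasStrictFDerivAt_equiv (hRne w₀ hw₀)).toOpenPartialHomeomorph Z
  have hes : w₀ ∈ e.source :=
    (hZs.hasStrictFDerivAt_equiv (hRne w₀ hw₀)).mem_toOpenPartialHomeomorph_source
  have he0 : e w₀ = 0 := hZ0
  have h0t : (0 : ℂ) ∈ e.target := he0 ▸ e.map_source hes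
  have hs0 : e.symm 0 = w₀ := by rw [← he0]; exact e.left_inv hes
  obtain ⟨δ, hδ, hball⟩ := Metric.isOpen_iff.1
    (e.symm.isOpen_inter_preimage (isOpen_ball (x := w₀) (ε := ε'))) 0
    ⟨h0t, by rw [Set.mem_preimage, hs0]; exact hw₀⟩
  refine ⟨e.symm, fun ζ => (R (e.symm ζ))⁻¹, δ, hδ, fun ζ hζ => ?_, ?_⟩
  · obtain ⟨h1, h2⟩ := hball hζ
    refine ⟨(hV _ h2).2, e.hasDerivAt_symm h1 (hRne _ h2) (hZ _ h2), ?_⟩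
    rw [← hR2 _ h2]
    have := hRne _ h2
    field_simp
  · have hZc : ∀ᶠ ξ in 𝓝 w₀, Z ξ ∈ ball (0 : ℂ) δ := by
      refine (hZ w₀ hw₀).continuousAt.eventually ?_
      rw [hZ0]
      exact ball_mem_nhds _ hδ
    filter_upwards [hZc, e.open_source.mem_nhds hes] with ξ h1 h2
    exact ⟨Z ξ, h1, e.left_inv h2⟩

theorem re_deriv_eq_zero_of_re_eq_zero {Φ Φ' : ℂ → ℂ} {ζ : ℂ} {δ : ℝ}
    (hΦ : ∀ t ∈ Set.Ioo (-δ) δ, HasDerivAt Φ (Φ' (ζ + (t : ℝ))) (ζ + (t : ℝ)))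
    (h : ∀ t ∈ Set.Ioo (-δ) δ, (Φ (ζ + (t : ℝ))).re = 0) :
    ∀ t ∈ Set.Ioo (-δ) δ, (Φ' (ζ + (t : ℝ))).re = 0 := by
  intro t ht
  have h1 : HasDerivAt (fun s : ℝ => Φ (ζ + s)) (Φ' (ζ + t)) t := by
    have h2 : HasDerivAt (fun s : ℝ => ζ + (s : ℂ)) 1 t := by
      simpa using (ofRealCLM.hasDerivAt (x := t)).const_add ζ
    simpa [Function.comp_def] using (hΦ t ht).comp t h2
  have h3 := (reCLM.hasFDerivAt.comp_hasDerivAt t h1)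
  have h4 : (fun s : ℝ => (0 : ℝ)) =ᶠ[𝓝 t] (reCLM ∘ fun s : ℝ => Φ (ζ + s)) := by
    filter_upwards [isOpen_Ioo.mem_nhds ht] with s hs
    simp [h s hs]
  exact (h3.congr_of_eventuallyEq h4).unique (hasDerivAt_const t 0)

/-- The differential equation for planar coordinate lines. -/
theorem im_eq_zero_of_planar {γ η q q' : ℂ → ℂ} {ζ β : ℂ} {δ A : ℝ} (hδ : 0 < δ)
    (hη0 : ∀ x ∈ ball ζ δ, η x ≠ 0)
    (hγ : ∀ x ∈ ball ζ δ, HasDerivAt γ (η x)⁻¹ x)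
    (hη : ∀ x ∈ ball ζ δ, HasDerivAt η (q x * η x) x)
    (hq : ∀ x ∈ ball ζ δ, HasDerivAt q (q' x) x)
    (hne : A ≠ 0 ∨ β ≠ 0)
    (h : ∀ t ∈ Set.Ioo (-δ) δ, ((A * γ (ζ + (t : ℝ)) + β) * η (ζ + (t : ℝ))).re = 0) :
    (q' ζ + q ζ ^ 2 / 2).im = 0 := by
  have hb : ∀ t ∈ Set.Ioo (-δ) δ, ζ + ((t : ℝ) : ℂ) ∈ ball ζ δ := by
    intro t ht
    simpa [abs_lt] using ht
  have h0 : (0 : ℝ) ∈ Set.Ioo (-δ) δ := ⟨by linarith, hδ⟩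
  have h1 := re_deriv_eq_zero_of_re_eq_zero (Φ := fun x => (A * γ x + β) * η x)
    (Φ' := fun x => A + (A * γ x + β) * (q x * η x)) (ζ := ζ) (δ := δ) (fun t ht => by
      have hx := hb t ht
      refine ((((hγ _ hx).const_mul (A : ℂ)).add_const β).mul (hη _ hx)).congr_deriv ?_
      field_simp [hη0 _ hx]) h
  have h2 := re_deriv_eq_zero_of_re_eq_zero
    (Φ := fun x => A + (A * γ x + β) * (q x * η x))
    (Φ' := fun x => A * q x + (A * γ x + β) * ((q' x + q x ^ 2) * η x)) (ζ := ζ) (δ := δ)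
    (fun t ht => by
      have hx := hb t ht
      refine (((((hγ _ hx).const_mul (A : ℂ)).add_const β).mul
        ((hq _ hx).mul (hη _ hx))).const_add (A : ℂ)).congr_deriv ?_
      have := hη0 _ hx
      simp only [Pi.mul_apply]
      field_simp) h1
  have e0 := h 0 h0
  have e1 := h1 0 h0
  have e2 := h2 0 h0
  simp only [ofReal_zero, add_zero] at e0 e1 e2
  have hηζ := hη0 ζ (mem_ball_self hδ)
  -- In terms of this real `s`, the two derivatives say `A = s Im q` and `A Re q = s Im (q' + q²)`.
  -- Eliminating `A` and using `Im q² = 2 Re q Im q` gives `s Im (q' + q²/2) = 0`.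
  obtain ⟨s, hs⟩ : ∃ s : ℝ, (A * γ ζ + β) * η ζ = s * I :=
    ⟨((A * γ ζ + β) * η ζ).im, by
      apply Complex.ext
      · rw [e0]; simp
      · rw [im_ofReal_mul]; simp⟩
  have e1' : A - s * (q ζ).im = 0 := by
    have : (A : ℂ) + (A * γ ζ + β) * (q ζ * η ζ) = A + (s * I) * q ζ := by rw [← hs]; ring
    rw [this] at e1
    simp at e1
    linarith
  have e2' : A * (q ζ).re - s * (q' ζ + q ζ ^ 2).im = 0 := by
    have : (A : ℂ) * q ζ + (A * γ ζ + β) * ((q' ζ + q ζ ^ 2) * η ζ) =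
      A * q ζ + (s * I) * (q' ζ + q ζ ^ 2) := by rw [← hs]; ring
    rw [this] at e2
    simp [-add_im] at e2
    linarith
  -- If `s = 0`, the first derivative forces `A = 0`, and `β η = 0` then forces `β = 0`.
  have hs0 : s ≠ 0 := by
    rintro rfl
    have hA : A = 0 := by simpa using e1'
    simp [hA, hηζ] at hs
    exact hne.elim (fun h => h hA) (fun h => h hs)
  have : s * (q' ζ + q ζ ^ 2 / 2).im = 0 := by
    simp [pow_two] at e2' ⊢
    right
    have : s * ((q' ζ).im + ((q ζ).re * (q ζ).im + (q ζ).im * (q ζ).re) / 2) = 0 := by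
      linear_combination -e2' + (q ζ).re * e1'
    exact (mul_eq_zero.1 this).resolve_left hs0
  exact (mul_eq_zero.1 this).resolve_left hs0

/-- Solution of `q' + q²/2 = const`: in terms of `γ`, the function `η⁻¹` is a quadratic
polynomial with real discriminant. -/
theorem exists_quadratic_of_im_eq_zero {γ η q q' : ℂ → ℂ} {ζ : ℂ} {δ : ℝ} (hδ : 0 < δ)
    (hη0 : ∀ x ∈ ball ζ δ, η x ≠ 0)
    (hγ : ∀ x ∈ ball ζ δ, HasDerivAt γ (η x)⁻¹ x)
    (hη : ∀ x ∈ ball ζ δ, HasDerivAt η (q x * η x) x)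
    (hq : ∀ x ∈ ball ζ δ, HasDerivAt q (q' x) x)
    (h : ∀ x ∈ ball ζ δ, (q' x + q x ^ 2 / 2).im = 0) :
    ∃ (a b c : ℂ) (D : ℝ), b ^ 2 - 4 * a * c = D ∧
      ∀ x ∈ ball ζ δ, (η x)⁻¹ = a * γ x ^ 2 + b * γ x + c := by
  have hconst : ∀ f : ℂ → ℂ, (∀ x ∈ ball ζ δ, HasDerivAt f 0 x) →
      ∃ c, ∀ x ∈ ball ζ δ, f x = c := fun f hf =>
    isOpen_ball.exists_is_const_of_deriv_eq_zero (convex_ball _ _).isPreconnected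
      (fun x hx => (hf x hx).differentiableAt.differentiableWithinAt)
      (fun x hx => (hf x hx).deriv)
  have hζ : ζ ∈ ball ζ δ := mem_ball_self hδ
  have hqd : DifferentiableOn ℂ q (ball ζ δ) := fun x hx =>
    (hq x hx).differentiableAt.differentiableWithinAt
  have hq'd : DifferentiableOn ℂ q' (ball ζ δ) :=
    (hqd.deriv isOpen_ball).congr fun x hx => (hq x hx).deriv.symm
  -- A holomorphic function with vanishing imaginary part is a real constant `κ`.
  obtain ⟨κ, hκ⟩ := AnalyticOnNhd.eq_const_add_im_mul_I_of_re_eq_const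
    (f := fun x => q' x + q x ^ 2 / 2) (c₀ := 0)
    ((hq'd.add ((hqd.pow 2).div_const 2)).analyticOnNhd isOpen_ball) h isOpen_ball
    ⟨⟨ζ, hζ⟩, (convex_ball _ _).isPreconnected⟩
  have hq' : ∀ x ∈ ball ζ δ, q' x = κ - q x ^ 2 / 2 := by
    intro x hx
    have := hκ x hx
    simp only [ofReal_zero, zero_mul, add_zero] at this
    linear_combination this
  have hq2 : ∀ x ∈ ball ζ δ, HasDerivAt q (κ - q x ^ 2 / 2) x := fun x hx =>
    hq' x hx ▸ hq x hx
  -- Regard `y = 1/η` as a function of `γ`. Since `dγ = y dζ`, one has `dy/dγ = -q` and `d²y/dγ² =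
  -- -(κ - q²/2) η`, which is constant. So `a`, `b`, `c` are the coefficients of the quadratic `y`,
  -- and its discriminant `(dy/dγ)² - 4 a y` is `2κ`.
  obtain ⟨a, ha⟩ := hconst (fun x => -((κ - q x ^ 2 / 2) * η x) / 2) (fun x hx => by
    refine (((((hq2 x hx).pow 2).div_const 2).const_sub (κ : ℂ)).mul
      (hη x hx)).neg.div_const 2 |>.congr_deriv ?_
    simp
    ring)
  obtain ⟨b, hb⟩ := hconst (fun x => -q x - 2 * a * γ x) (fun x hx => by
    refine ((hq2 x hx).neg.sub ((hγ x hx).const_mul (2 * a))).congr_deriv ?_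
    rw [← ha x hx]
    field_simp [hη0 x hx]
    ring)
  obtain ⟨c, hc⟩ := hconst (fun x => (η x)⁻¹ - a * γ x ^ 2 - b * γ x) (fun x hx => by
    refine ((((hη x hx).inv (hη0 x hx)).sub (((hγ x hx).pow 2).const_mul a)).sub
      ((hγ x hx).const_mul b)).congr_deriv ?_
    rw [← hb x hx]
    have := hη0 x hx
    simp
    field_simp
    ring)
  refine ⟨a, b, c, 2 * κ, ?_, fun x hx => by linear_combination hc x hx⟩
  have h1 := ha ζ hζ
  have h2 := hb ζ hζ
  have h3 := hc ζ hζ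
  have h4 : η ζ * (η ζ)⁻¹ = 1 := mul_inv_cancel₀ (hη0 ζ hζ)
  push_cast
  rw [← h3]
  have hb' : b + 2 * a * γ ζ = -q ζ := by linear_combination -h2
  have : b ^ 2 - 4 * a * ((η ζ)⁻¹ - a * γ ζ ^ 2 - b * γ ζ) =
    (b + 2 * a * γ ζ) ^ 2 - 4 * a * (η ζ)⁻¹ := by ring
  rw [this, hb', ← h1]
  linear_combination 2 * (κ - q ζ ^ 2 / 2) * h4

/-- The equation of an affine plane of isotropic 3-space. -/
theorem exists_equation_of_plane {P : AffineSubspace ℝ R31}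
    (hP : (P : Set R31) ⊆ isotropicSpace) (hdim : Module.finrank ℝ P.direction = 2) :
    ∃ (A : ℝ) (β : ℂ) (d : ℝ), (A ≠ 0 ∨ β ≠ 0) ∧
      ∀ x ∈ P, A * x 0 + (β * planeProj x).re = d := by
  -- `T` parametrizes isotropic 3-space by `(l, x, y)`. Its three-dimensional range cannot lie in
  -- the direction of `P`, so some nonzero functional on it kills that direction; this functional is
  -- the equation.
  let T : (Fin 3 → ℝ) →ₗ[ℝ] R31 :=
    { toFun := fun c => ![c 0, c 1, c 2, c 0]
      map_add' := fun x y => by ext i; fin_cases i <;> simp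
      map_smul' := fun r x => by ext i; fin_cases i <;> simp }
  have hT : Function.Injective T := by
    intro x y hxy
    have h0 : x 0 = y 0 := congrFun hxy 0
    have h1 : x 1 = y 1 := congrFun hxy 1
    have h2 : x 2 = y 2 := congrFun hxy 2
    ext i
    fin_cases i <;> assumption
  obtain ⟨c, hc⟩ : ∃ c, T c ∉ P.direction := by
    by_contra! hall
    have h1 : LinearMap.range T ≤ P.direction := by
      rintro _ ⟨c, rfl⟩
      exact hall c
    have h2 := Submodule.finrank_mono h1
    rw [LinearMap.finrank_range_of_inj hT, hdim] at h2
    simp at h2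
  obtain ⟨f, hfc, hfD⟩ := Submodule.exists_dual_map_eq_bot_of_notMem hc inferInstance
  have hf0 : ∀ v ∈ P.direction, f v = 0 := by
    intro v hv
    have : f v ∈ P.direction.map f := ⟨v, hv, rfl⟩
    rw [hfD] at this
    simpa using this
  have hfT : ∀ c, f (T c) = f (T ![1, 0, 0]) * c 0 +
      ((f (T ![0, 1, 0]) - f (T ![0, 0, 1]) * I : ℂ) * (c 1 + c 2 * I)).re := by
    intro c
    have : c = c 0 • ![1, 0, 0] + c 1 • ![0, 1, 0] + c 2 • ![0, 0, 1] := by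
      ext i; fin_cases i <;> simp
    conv_lhs => rw [this]
    simp only [map_add, map_smul, smul_eq_mul, mul_re, sub_re, ofReal_re, add_re, I_re, I_im,
      sub_im, add_im, ofReal_im, mul_im]
    ring
  have hPne : (P : Set R31).Nonempty := by
    by_contra h
    rw [Set.not_nonempty_iff_eq_empty, AffineSubspace.coe_eq_bot_iff] at h
    rw [h, AffineSubspace.direction_bot, finrank_bot] at hdim
    exact absurd hdim (by norm_num)
  obtain ⟨x₀, hx₀⟩ := hPne
  refine ⟨f (T ![1, 0, 0]), (f (T ![0, 1, 0]) - f (T ![0, 0, 1]) * I : ℂ), f x₀, ?_, ?_⟩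
  · by_contra! h
    apply hfc
    rw [hfT, h.1, h.2]
    simp
  · intro x hx
    have h1 : x = T ![x 0, x 1, x 2] := by
      ext i
      fin_cases i
      · simp [T]
      · simp [T]
      · simp [T]
      · simpa [T] using mem_isotropicSpace.1 (hP hx)
    have h2 : f x = f x₀ := by
      have := hf0 _ (AffineSubspace.vsub_mem_direction hx hx₀)
      rw [vsub_eq_sub, map_sub] at this
      linarith
    rw [← h2]
    conv_rhs => rw [h1, hfT]
    simp

end

section

/-! ### Surfaces with planar curvature lines -/

variable {S : Set ℂ} {X : ℂ → R31} {p : ℂ → ℂ}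

theorem IsLocalCoord.surjective {w : ℂ → ℂ} (hw : IsLocalCoord S w) {z : ℂ} (hz : z ∈ S) :
    Function.Surjective (fderiv ℝ w z) :=
  (LinearMap.injective_iff_surjective (f := (fderiv ℝ w z : ℂ →ₗ[ℝ] ℂ))).1 (hw.injective z hz)

theorem secondForm_eq_of_hasCoordDeriv (hX : IsSpacelikeImmersion S X) (hS : IsOpen S)
    (hp : HasCoordDeriv S (planeCoord X) (gaussCoord X) p) {z : ℂ} (hz : z ∈ S) (u v : ℂ) :
    secondForm X z u v =
      (p z * fderiv ℝ (planeCoord X) z u * fderiv ℝ (planeCoord X) z v).re := by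
  rw [hX.secondForm_eq hS hz, (hp z hz).fderiv]
  simp

/-- `Re (p dw²)` is trace-free for `|dw|²`, so it can be a multiple of it only when `p = 0`; vectors
with `dw = 1` and `dw = i` detect this. -/
theorem not_isUmbilic (hX : IsSpacelikeImmersion S X) (hS : IsOpen S)
    (hp : HasCoordDeriv S (planeCoord X) (gaussCoord X) p) {z : ℂ} (hz : z ∈ S) (h : p z ≠ 0) :
    ¬ IsUmbilic X z := by
  rintro ⟨k, hk⟩
  have hsurj := (hX.isLocalCoord hS).surjective hz
  obtain ⟨u, hu⟩ := hsurj 1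
  obtain ⟨v, hv⟩ := hsurj I
  have h1 := hk u u
  have h2 := hk u v
  have h3 := hk v v
  simp only [secondForm_eq_of_hasCoordDeriv hX hS hp hz, hX.firstForm_eq hS hz, hu, hv] at h1 h2 h3
  simp at h1 h2 h3
  exact h (Complex.ext (by simp; linarith) (by simpa using h2))

/-- In the coordinate `ζ` the forms are `II = Re dζ²` and `I = |η|² |dζ|²`, both diagonal.
Horizontal lines are therefore principal, with curvature `|η|⁻²`. -/
theorem isCurvatureLine_of_coord (hX : IsSpacelikeImmersion S X) (hS : IsOpen S)
    (hp : HasCoordDeriv S (planeCoord X) (gaussCoord X) p) {z₀ : ℂ} {σ : ℂ → ℂ} {ε : ℝ}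
    (hσ : IsLocalSection S (planeCoord X) z₀ σ ε) {u η : ℂ → ℂ} {ζ : ℂ} {δ : ℝ}
    (hu : ∀ x ∈ ball ζ δ, u x ∈ ball (planeCoord X z₀) ε ∧ HasDerivAt u (η x) x ∧
      p (σ (u x)) * η x ^ 2 = 1) :
    IsCurvatureLine S X (fun t : ℝ => σ (u (ζ + t))) (-δ) δ ∧
    ∀ t ∈ Set.Ioo (-δ) δ, HasDerivAt (fun t : ℝ => σ (u (ζ + t)))
      (fderiv ℝ σ (u (ζ + t)) (η (ζ + t))) t := by
  have hw := hX.isLocalCoord hS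
  have hb : ∀ t ∈ Set.Ioo (-δ) δ, ζ + ((t : ℝ) : ℂ) ∈ ball ζ δ := by
    intro t ht
    simpa [abs_lt] using ht
  have hline : ∀ t : ℝ, HasDerivAt (fun s : ℝ => ζ + (s : ℂ)) 1 t := fun t => by
    simpa using (ofRealCLM.hasDerivAt (x := t)).const_add ζ
  have hder : ∀ t ∈ Set.Ioo (-δ) δ, HasDerivAt (fun t : ℝ => σ (u (ζ + t)))
      (fderiv ℝ σ (u (ζ + t)) (η (ζ + t))) t := by
    intro t ht
    obtain ⟨h1, h2, -⟩ := hu _ (hb t ht)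
    have h3 : HasDerivAt (fun s : ℝ => u (ζ + s)) (η (ζ + t)) t := by
      simpa [Function.comp_def] using h2.comp t (hline t)
    exact ((hσ.smooth _ h1).differentiableAt (by simp)).hasFDerivAt.comp_hasDerivAt t h3
  refine ⟨⟨?_, fun t ht => ?_⟩, hder⟩
  · intro t ht
    have hud : DifferentiableOn ℂ u (ball ζ δ) := fun x hx =>
      (hu x hx).2.1.differentiableAt.differentiableWithinAt
    have h1 : ContDiffAt ℂ ∞ u (ζ + t) :=
      (hud.contDiffOn isOpen_ball).contDiffAt (isOpen_ball.mem_nhds (hb t ht))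
    have h2 : ContDiffAt ℝ ∞ (fun s : ℝ => ζ + (s : ℂ)) t :=
      contDiffAt_const.add ofRealCLM.contDiff.contDiffAt
    exact ((hσ.smooth _ (hu _ (hb t ht)).1).comp t
      ((h1.restrict_scalars ℝ).comp t h2)).contDiffWithinAt
  · obtain ⟨h1, h2, h3⟩ := hu _ (hb t ht)
    have hmem := hσ.mem _ h1
    have hη : η (ζ + t) ≠ 0 := by
      intro h
      simp [h] at h3
    have hdw := hσ.fderiv_comp hw h1 (η (ζ + t))
    refine ⟨hmem, not_isUmbilic hX hS hp hmem (fun h => by simp [h] at h3), ?_, ?_⟩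
    · rw [(hder t ht).deriv]
      intro h
      rw [h, map_zero] at hdw
      exact hη hdw.symm
    · refine ⟨(normSq (η (ζ + t)))⁻¹, fun v => ?_⟩
      rw [(hder t ht).deriv, secondForm_eq_of_hasCoordDeriv hX hS hp hmem,
        hX.firstForm_eq hS hmem, hdw]
      have h4 : p (σ (u (ζ + t))) * η (ζ + t) = (η (ζ + t))⁻¹ := by
        field_simp
        linear_combination h3
      rw [h4, Complex.inv_def, mul_assoc, mul_comm (((normSq (η (ζ + t)))⁻¹ : ℝ) : ℂ), ← mul_assoc,
        mul_comm _ (((normSq (η (ζ + t)))⁻¹ : ℝ) : ℂ), re_ofReal_mul]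
      simp

/-- In the coordinate `ζ` with `p dw² = dζ²`, `dg/dζ = p η = 1/η`, so planarity of the horizontal
lines makes `1/η` a quadratic in `g`, while `p = (1/η)²`. Only one of the two families of curvature
lines is needed. -/
theorem exists_quadratic_near (hX : IsSpacelikeImmersion S X) (hS : IsOpen S)
    (hp : HasCoordDeriv S (planeCoord X) (gaussCoord X) p) (hP : HasPlanarCurvatureLines S X)
    {z₀ : ℂ} (hz₀ : z₀ ∈ S) (h0 : p z₀ ≠ 0) :
    ∃ (a b c : ℂ) (D : ℝ), b ^ 2 - 4 * a * c = D ∧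
      ∀ᶠ z in 𝓝 z₀, p z = (a * gaussCoord X z ^ 2 + b * gaussCoord X z + c) ^ 2 := by
  have hw := hX.isLocalCoord hS
  obtain ⟨σ, ε, hσ⟩ := hw.exists_isLocalSection hz₀
  obtain ⟨u, η, δ, hδ, hu, hopen⟩ := exists_coord_quadratic_differential hσ.pos
    (hσ.differentiableOn_comp hw (hp.isCoordHolo_deriv hw)) (by simpa [hσ.center] using h0)
  have hη0 : ∀ x ∈ ball (0 : ℂ) δ, η x ≠ 0 := by
    intro x hx h
    simpa [h] using (hu x hx).2.2
  have hud : DifferentiableOn ℂ u (ball 0 δ) := fun x hx =>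
    (hu x hx).2.1.differentiableAt.differentiableWithinAt
  have hηd : DifferentiableOn ℂ η (ball 0 δ) :=
    (hud.deriv isOpen_ball).congr fun x hx => (hu x hx).2.1.deriv.symm
  set q : ℂ → ℂ := fun x => deriv η x / η x with hq
  have hqd : DifferentiableOn ℂ q (ball 0 δ) := (hηd.deriv isOpen_ball).div hηd hη0
  have hη : ∀ x ∈ ball (0 : ℂ) δ, HasDerivAt η (q x * η x) x := by
    intro x hx
    rw [hq, div_mul_cancel₀ _ (hη0 x hx)]
    exact (hηd.differentiableAt (isOpen_ball.mem_nhds hx)).hasDerivAt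
  have hq' : ∀ x ∈ ball (0 : ℂ) δ, HasDerivAt q (deriv q x) x := fun x hx =>
    (hqd.differentiableAt (isOpen_ball.mem_nhds hx)).hasDerivAt
  have hγ : ∀ x ∈ ball (0 : ℂ) δ,
      HasDerivAt (fun x => gaussCoord X (σ (u x))) (η x)⁻¹ x := by
    intro x hx
    obtain ⟨h1, h2, h3⟩ := hu x hx
    refine ((hσ.hasDerivAt_comp hw hp h1).comp x h2).congr_deriv ?_
    have := hη0 x hx
    field_simp
    linear_combination h3
  have him : ∀ x ∈ ball (0 : ℂ) δ, (deriv q x + q x ^ 2 / 2).im = 0 := by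
    intro ζ hζ
    obtain ⟨δ', hδ', hsub⟩ := Metric.isOpen_iff.1 isOpen_ball ζ hζ
    obtain ⟨hline, hder⟩ := isCurvatureLine_of_coord hX hS hp hσ (fun x hx => hu x (hsub hx))
    obtain ⟨P, hPiso, hdim, hmem⟩ := hP _ _ _ hline
    obtain ⟨A, β, d, hne, heq⟩ := exists_equation_of_plane hPiso hdim
    refine im_eq_zero_of_planar (q' := deriv q) hδ' (fun x hx => hη0 x (hsub hx))
      (fun x hx => hγ x (hsub hx)) (fun x hx => hη x (hsub hx)) (fun x hx => hq' x (hsub hx))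
      hne fun t ht => ?_
    have hx : ζ + ((t : ℝ) : ℂ) ∈ ball ζ δ' := by simpa [abs_lt] using ht
    have h1 := (hu _ (hsub hx)).1
    -- Differentiate the plane equation along the line, where `dw/dt = η` and `dl/dt = Re (g η)`.
    have hX1 := (hX.hasFDerivAt hS (hσ.mem _ h1)).comp_hasDerivAt t (hder t ht)
    have hl := hasDerivAt_pi.1 hX1 0
    have hpl := (planeProj.hasFDerivAt.comp_hasDerivAt t hX1).const_mul β
    have hsum := (hl.const_mul A).add (reCLM.hasFDerivAt.comp_hasDerivAt t hpl)
    have hconst := hsum.congr_of_eventuallyEq (f₁ := fun _ => d) (by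
      filter_upwards [isOpen_Ioo.mem_nhds ht] with s hs
      simpa using (heq _ (hmem s hs)).symm)
    have hfin := hconst.unique (hasDerivAt_const t d)
    have hw2 : planeProj (fderiv ℝ X (σ (u (ζ + t))) (fderiv ℝ σ (u (ζ + t)) (η (ζ + t)))) =
        η (ζ + t) := by
      rw [← hσ.fderiv_comp hw h1 (η (ζ + t)), hX.fderiv_planeCoord hS (hσ.mem _ h1),
        ContinuousLinearMap.comp_apply]
      congr 3
      rw [← ContinuousLinearMap.comp_apply, ← hX.fderiv_planeCoord hS (hσ.mem _ h1),
        hσ.fderiv_comp hw h1]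
    rw [hw2, hX.fderiv_zero hS (hσ.mem _ h1), hσ.fderiv_comp hw h1] at hfin
    rw [add_mul, add_re, mul_assoc, re_ofReal_mul]
    simpa using hfin
  obtain ⟨a, b, c, D, hD, hquad⟩ := exists_quadratic_of_im_eq_zero hδ hη0 hγ hη hq' him
  refine ⟨a, b, c, D, hD, ?_⟩
  have hcont : ContinuousAt (planeCoord X) z₀ :=
    (hw.smooth.contDiffAt (hS.mem_nhds hz₀)).continuousAt
  filter_upwards [hσ.left_inv, hcont.eventually hopen] with z h1 h2
  obtain ⟨ζ, hζ, hζz⟩ := h2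
  have h3 := (hu ζ hζ).2.2
  have h4 := hquad ζ hζ
  rw [hζz, h1.2] at h3 h4
  rw [← h4]
  have := hη0 ζ hζ
  field_simp
  exact h3

/-- Either `p` vanishes, or it is the square of a nowhere vanishing quadratic polynomial
of real discriminant in the Gauss map. -/
theorem exists_quadratic (hX : IsSpacelikeImmersion S X) (hS : IsOpen S)
    (hSc : IsPreconnected S)
    (hp : HasCoordDeriv S (planeCoord X) (gaussCoord X) p) (hP : HasPlanarCurvatureLines S X) :
    (∀ z ∈ S, p z = 0) ∨
    ∃ (a b c : ℂ) (D : ℝ), b ^ 2 - 4 * a * c = D ∧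
      ∀ z ∈ S, p z = (a * gaussCoord X z ^ 2 + b * gaussCoord X z + c) ^ 2 ∧
        a * gaussCoord X z ^ 2 + b * gaussCoord X z + c ≠ 0 := by
  by_cases h : ∀ z ∈ S, p z = 0
  · exact Or.inl h
  right
  push Not at h
  obtain ⟨z₀, hz₀, h0⟩ := h
  have hw := hX.isLocalCoord hS
  obtain ⟨a, b, c, D, hD, hev⟩ := exists_quadratic_near hX hS hp hP hz₀ h0
  have hg := hp.isCoordHolo
  have hQ : ∀ x, HasDerivAt (fun x : ℂ => a * x ^ 2 + b * x + c) (2 * a * x + b) x := by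
    intro x
    refine ((((hasDerivAt_pow 2 x).const_mul a).add ((hasDerivAt_id x).const_mul b)).add_const
      c).congr_deriv ?_
    simp
    ring
  have hQd : Differentiable ℂ (fun x : ℂ => a * x ^ 2 + b * x + c) := fun x =>
    (hQ x).differentiableAt
  have hpe : ∀ z ∈ S, p z = (a * gaussCoord X z ^ 2 + b * gaussCoord X z + c) ^ 2 := by
    have := ((hp.isCoordHolo_deriv hw).sub (hg.comp_differentiable (hQd.pow 2))).eqOn_zero hw hSc
      hz₀ (hev.mono fun z hz => by simp [hz])
    intro z hz
    simpa using sub_eq_zero.1 (this z hz)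
  refine ⟨a, b, c, D, hD, fun z hz => ⟨hpe z hz, fun hzero => ?_⟩⟩
  -- With `p = Q(g)²`, the function `Q(g)` satisfies `d Q(g) = (Q'(g) Q(g)) Q(g) dw`, a linear
  -- equation. A single zero would make it vanish identically, contradicting `p z₀ ≠ 0`.
  have hlin : HasCoordDeriv S (planeCoord X)
      (fun z => a * gaussCoord X z ^ 2 + b * gaussCoord X z + c)
      (fun z => ((2 * a * gaussCoord X z + b) * (a * gaussCoord X z ^ 2 + b * gaussCoord X z + c)) *
        (a * gaussCoord X z ^ 2 + b * gaussCoord X z + c)) :=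
    (hp.comp_hasDerivAt (φ := fun x => a * x ^ 2 + b * x + c) (φ' := fun x => 2 * a * x + b)
      fun z _ => hQ (gaussCoord X z)).congr_deriv fun z hz => by
      simp only [hpe z hz]
      ring
  have hk : IsCoordHolo S (planeCoord X) (fun z => (2 * a * gaussCoord X z + b) *
      (a * gaussCoord X z ^ 2 + b * gaussCoord X z + c)) :=
    (hg.comp_differentiable (φ := fun x => 2 * a * x + b)
      ((differentiable_id.const_mul (2 * a)).add_const b)).mul (hg.comp_differentiable hQd)
  have := hlin.eq_zero_of_linear hk hw hSc hz hzero z₀ hz₀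
  apply h0
  rw [hpe z₀ hz₀, this]
  simp

end

section

/-! ### Similarities of isotropic 3-space -/

/-- The shear `l ↦ l + Re (c w)` preserves the degenerate metric and extends to Minkowski space as a
null rotation fixing `𝔭`; the unit number `e` adds a rotation of the `(x, y)`-plane. -/
theorem exists_isSimilarity {r : ℝ} {e c b : ℂ} (b₀ : ℝ) (hr : r ≠ 0) (he : normSq e = 1) :
    ∃ Φ, IsSimilarity Φ ∧ ∀ (l : ℝ) (w : ℂ), Φ (ofCoords l w.re w.im) =
      ofCoords (r * (l + (c * w).re) + b₀) (r * e * w + b).re (r * e * w + b).im := by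
  rw [normSq_apply] at he
  let s : ℂ := e * (starRingEnd ℂ) c
  -- The action on isotropic 3-space prescribes the middle columns and `A 𝔭 = 𝔭`; `s` and `m` are
  -- then forced by the Lorentz condition on the first column.
  let m : ℝ := (c.re ^ 2 + c.im ^ 2) / 2
  let A : Matrix (Fin 4) (Fin 4) ℝ :=
    !![1 + m, c.re, -c.im, -m;
       s.re, e.re, -e.im, -s.re;
       s.im, e.im, e.re, -s.im;
       m, c.re, -c.im, 1 - m]
  have hA : ∀ x : R31, A.mulVec x = ![(1 + m) * x 0 + c.re * x 1 - c.im * x 2 - m * x 3,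
      s.re * x 0 + e.re * x 1 - e.im * x 2 - s.re * x 3,
      s.im * x 0 + e.im * x 1 + e.re * x 2 - s.im * x 3,
      m * x 0 + c.re * x 1 - c.im * x 2 + (1 - m) * x 3] := by
    intro x
    ext i
    fin_cases i <;> simp [A, Matrix.mulVec, dotProduct, Fin.sum_univ_four] <;> ring
  refine ⟨fun x => r • A.mulVec x + ofCoords b₀ b.re b.im,
    ⟨r, A, ofCoords b₀ b.re b.im, hr, ⟨?_, ?_, ?_⟩, ?_, fun x => rfl⟩, ?_⟩
  · intro x y
    rw [hA, hA]
    simp [mink, s, m]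
    linear_combination (x 1 * y 1 + x 2 * y 2 + (x 0 - x 3) * (c.re * y 1 - c.im * y 2) +
      (y 0 - y 3) * (c.re * x 1 - c.im * x 2) +
      (c.re ^ 2 + c.im ^ 2) * (x 0 - x 3) * (y 0 - y 3)) * he
  · simp [A, Matrix.det_succ_row_zero, Fin.sum_univ_succ, Fin.succAbove, s, m]
    linear_combination he
  · rw [hA]
    ext i
    fin_cases i <;> simp [pVec]
  · rw [mem_isotropicSpace]
    simp [ofCoords]
  · intro l w
    simp only [hA]
    ext i
    fin_cases i <;> simp [ofCoords, -mul_eq_mul_left_iff] <;> ring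

/-- Since `A` fixes `𝔭` and preserves `⟨·, 𝔭⟩`, its middle block is an orthogonal `2 × 2` matrix
whose determinant equals `det A = 1`: a rotation, hence multiplication by a complex number. -/
theorem IsSimilarity.exists_coords {Φ : R31 → R31} (hΦ : IsSimilarity Φ) :
    ∃ (r : ℝ) (e c b : ℂ) (b₀ : ℝ), r ≠ 0 ∧ e ≠ 0 ∧ ∀ (l : ℝ) (w : ℂ),
      Φ (ofCoords l w.re w.im) 0 = r * (l + (c * w).re) + b₀ ∧
      planeProj (Φ (ofCoords l w.re w.im)) = r * e * w + b := by
  obtain ⟨r, A, b, hr, ⟨hA, hdet, hp⟩, hb, hΦ⟩ := hΦ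
  have hmul : ∀ x : R31, ∀ i, A.mulVec x i =
      A i 0 * x 0 + A i 1 * x 1 + A i 2 * x 2 + A i 3 * x 3 := by
    intro x i
    simp [Matrix.mulVec, dotProduct, Fin.sum_univ_four]
  have hp' : ∀ i, A i 3 = pVec i - A i 0 := by
    intro i
    have := congrFun hp i
    rw [hmul] at this
    simp [pVec] at this ⊢
    linarith
  have hrow : ∀ x : R31, -A.mulVec x 0 + A.mulVec x 3 = -x 0 + x 3 := by
    intro x
    have := hA x pVec
    rw [hp] at this
    simpa [mink, pVec] using this
  have r0 := hrow ![1, 0, 0, 0]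
  have r1 := hrow ![0, 1, 0, 0]
  have r2 := hrow ![0, 0, 1, 0]
  have m11 := hA ![0, 1, 0, 0] ![0, 1, 0, 0]
  have m12 := hA ![0, 1, 0, 0] ![0, 0, 1, 0]
  have m22 := hA ![0, 0, 1, 0] ![0, 0, 1, 0]
  have q0 := hp' 0
  have q1 := hp' 1
  have q2 := hp' 2
  have q3 := hp' 3
  simp [hmul] at r0 r1 r2
  simp [mink, hmul] at m11 m12 m22
  simp [pVec] at q0 q1 q2 q3
  have e31 : A 3 1 = A 0 1 := by linarith
  have e32 : A 3 2 = A 0 2 := by linarith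
  have e30 : A 3 0 = A 0 0 - 1 := by linarith
  rw [e31] at m11 m12
  rw [e32] at m12 m22
  have hd : A 1 1 * A 2 2 - A 2 1 * A 1 2 = 1 := by
    rw [← hdet]
    simp [Matrix.det_succ_row_zero, Fin.sum_univ_succ, Fin.succAbove]
    rw [q0, q1, q2, q3, e31, e32, e30]
    ring
  have f1 : A 1 2 = -A 2 1 := by
    linear_combination A 1 1 * m12 - A 1 2 * m11 - A 2 1 * hd
  have f2 : A 2 2 = A 1 1 := by
    linear_combination A 2 1 * m12 - A 2 2 * m11 + A 1 1 * hd
  refine ⟨r, A 1 1 + A 2 1 * I, A 0 1 - A 0 2 * I, b 1 + b 2 * I, b 0, hr, ?_, ?_⟩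
  · intro h
    have h1 := congrArg Complex.re h
    have h2 := congrArg Complex.im h
    simp at h1 h2
    rw [h1, h2] at m11
    norm_num at m11
  · intro l w
    rw [hΦ]
    simp only [planeProj_apply, Pi.add_apply, Pi.smul_apply, hmul, smul_eq_mul, ofCoords]
    simp [q0, q1, q2, f1, f2, -mul_eq_mul_left_iff]
    refine ⟨by ring, ?_⟩
    apply Complex.ext <;> simp <;> ring

/-! ### The surface with given Weierstrass data -/

/-- `L` and `W` are the primitives of `h η` and `η` that vanish at `0`. -/
structure IsWeierstrassPrimitive (h η L W : ℂ → ℂ) : Prop where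
  left_zero : L 0 = 0
  right_zero : W 0 = 0
  left : ∀ z, HasDerivAt L (h z * η z) z
  right : ∀ z, HasDerivAt W (η z) z

theorem integral_segment_eq {F f : ℂ → ℂ} (hF : ∀ z, HasDerivAt F (f z) z) (h0 : F 0 = 0)
    (z : ℂ) : ∫ t in (0 : ℝ)..1, f (t * z) * z = F z := by
  have hf : Continuous f := by
    have h1 : Differentiable ℂ F := fun z => (hF z).differentiableAt
    have h2 : f = deriv F := funext fun z => (hF z).deriv.symm
    rw [h2]
    exact (h1.contDiff (n := 1)).continuous_deriv le_rfl
  have hd : ∀ t ∈ Set.uIcc (0 : ℝ) 1, HasDerivAt (fun t : ℝ => F (t * z)) (f (t * z) * z) t := by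
    intro t _
    have : HasDerivAt (fun t : ℝ => (t : ℂ) * z) z t := by
      simpa using (ofRealCLM.hasDerivAt (x := t)).mul_const z
    exact (hF _).comp t this
  rw [intervalIntegral.integral_eq_sub_of_hasDerivAt hd
    (by apply Continuous.intervalIntegrable; fun_prop)]
  simp [h0]

variable {h η L W h' : ℂ → ℂ}

theorem IsWeierstrassPrimitive.weierstrassSurface_eq (H : IsWeierstrassPrimitive h η L W)
    (z : ℂ) : weierstrassSurface h η z = ofCoords (L z).re (W z).re (W z).im := by
  rw [weierstrassSurface, integral_segment_eq H.left H.left_zero,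
    integral_segment_eq H.right H.right_zero,
    integral_segment_eq (F := fun z => -I * W z) (fun z => (H.right z).const_mul (-I))
      (by simp [H.right_zero])]
  simp

variable {S : Set ℂ} {X : ℂ → R31} {p : ℂ → ℂ}

/-- Necessary conditions on the Gauss map for `X` to be a piece of a given surface. -/
theorem IsWeierstrassPrimitive.exists_of_isPieceOf (H : IsWeierstrassPrimitive h η L W)
    (hX : IsSpacelikeImmersion S X) (hS : IsOpen S)
    (hp : HasCoordDeriv S (planeCoord X) (gaussCoord X) p)
    (hh : ∀ y, η y ≠ 0 → HasDerivAt h (h' y) y) (hpiece : IsPieceOf S X h η) :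
    ∃ (r : ℝ) (e c : ℂ), r ≠ 0 ∧ e ≠ 0 ∧ ∀ z ∈ S, ∃ y, η y ≠ 0 ∧
      gaussCoord X z * e = h y + c ∧ p z * r * e ^ 2 * η y = h' y := by
  obtain ⟨Φ, ψ, hΦ, hψ, hinj, hXΦ⟩ := hpiece
  obtain ⟨r, e, c, b, b₀, hr, he, hcoord⟩ := hΦ.exists_coords
  have hw := hX.isLocalCoord hS
  have hr' : (r : ℂ) ≠ 0 := by exact_mod_cast hr
  have hψd : ∀ z ∈ S, HasFDerivAt ψ (fderiv ℝ ψ z) z := fun z hz =>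
    ((hψ.contDiffAt (hS.mem_nhds hz)).differentiableAt (by simp)).hasFDerivAt
  have hX0 : ∀ z ∈ S, X z 0 = r * ((L (ψ z)).re + (c * W (ψ z)).re) + b₀ := fun z hz => by
    rw [hXΦ z hz, H.weierstrassSurface_eq, (hcoord _ _).1]
  have hX1 : ∀ z ∈ S, planeCoord X z = r * e * W (ψ z) + b := fun z hz => by
    rw [← (hcoord (L (ψ z)).re (W (ψ z))).2, ← H.weierstrassSurface_eq, ← hXΦ z hz]
    simp [planeCoord]
  have hdw : ∀ z ∈ S, ∀ v, fderiv ℝ (planeCoord X) z v = r * e * η (ψ z) * fderiv ℝ ψ z v := by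
    intro z hz v
    have h1 := (((H.right (ψ z)).const_mul (r * e : ℂ)).add_const b).hasFDerivAt.restrictScalars ℝ
    have h2 := (h1.comp z (hψd z hz)).congr_of_eventuallyEq (f₁ := planeCoord X) (by
      filter_upwards [hS.mem_nhds hz] with y hy using hX1 y hy)
    rw [h2.fderiv]
    simp
    ring
  -- Branch points of the model surface are avoided because `dw = r e η dψ` is invertible.
  have hη : ∀ z ∈ S, η (ψ z) ≠ 0 := by
    intro z hz h0
    have := hdw z hz 1
    rw [h0] at this
    exact hw.fderiv_one_ne_zero hz (by simpa using this)
  have hg : ∀ z ∈ S, gaussCoord X z * e = h (ψ z) + c := by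
    intro z hz
    have hsurj : Function.Surjective (fderiv ℝ ψ z) :=
      (LinearMap.injective_iff_surjective (f := (fderiv ℝ ψ z : ℂ →ₗ[ℝ] ℂ))).1 (hinj z hz)
    have h1 := (((H.left (ψ z)).add ((H.right (ψ z)).const_mul c)).const_mul
      (r : ℂ)).hasFDerivAt.restrictScalars ℝ
    have h2 := (reCLM.hasFDerivAt.comp z (h1.comp z (hψd z hz))).add_const b₀
    have h3 := h2.congr_of_eventuallyEq (f₁ := fun y => X y 0) (by
      filter_upwards [hS.mem_nhds hz] with y hy
      rw [hX0 y hy]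
      simp)
    have h4 := (hasFDerivAt_pi'.1 (hX.hasFDerivAt hS hz) 0).unique h3
    have h5 : ∀ v, ((gaussCoord X z * e - h (ψ z) - c) * (r * η (ψ z) * fderiv ℝ ψ z v)).re = 0 := by
      intro v
      have h6 := congrArg (fun L : ℂ →L[ℝ] ℝ => L v) h4
      have h7 := hX.fderiv_zero hS hz v
      rw [hdw z hz] at h7
      have h8 : fderiv ℝ X z v 0 =
          (fderiv ℝ ψ z v * (r * (h (ψ z) * η (ψ z) + c * η (ψ z)))).re := by
        simpa [-mul_re] using h6
      rw [h7] at h8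
      rw [← sub_eq_zero, ← sub_re] at h8
      rw [← h8]
      congr 1
      ring
    -- For this `v` the vanishing real part is the squared modulus of `g e - h - c`.
    obtain ⟨v, hv⟩ := hsurj ((starRingEnd ℂ) (gaussCoord X z * e - h (ψ z) - c) / (r * η (ψ z)))
    have h9 := h5 v
    rw [hv, mul_div_cancel₀ _ (mul_ne_zero hr' (hη z hz)), mul_conj, ofReal_re, normSq_eq_zero]
      at h9
    linear_combination h9
  refine ⟨r, e, c, hr, he, fun z hz => ⟨ψ z, hη z hz, hg z hz, ?_⟩⟩
  have h1 := ((hh _ (hη z hz)).add_const c).hasFDerivAt.restrictScalars ℝ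
  have h2 := (h1.comp z (hψd z hz)).congr_of_eventuallyEq (f₁ := fun y => gaussCoord X y * e) (by
    filter_upwards [hS.mem_nhds hz] with y hy using hg y hy)
  have h3 := ((hp z hz).mul_const e).unique h2
  have h4 := congrArg (fun L : ℂ →L[ℝ] ℂ => L 1) h3
  simp [hdw z hz] at h4
  have h5 : fderiv ℝ ψ z 1 ≠ 0 := fun h =>
    one_ne_zero (hinj z hz (h.trans (map_zero _).symm))
  refine mul_right_cancel₀ h5 ?_
  linear_combination h4

/-- Sufficient conditions on the Gauss map for `X` to be a piece of a given surface. -/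
theorem IsWeierstrassPrimitive.isPieceOf (H : IsWeierstrassPrimitive h η L W)
    (hX : IsSpacelikeImmersion S X) (hS : IsOpen S) (hSc : IsPreconnected S)
    {r : ℝ} {e c : ℂ} (hr : r ≠ 0) (he : normSq e = 1) {ψ τ : ℂ → ℂ}
    (hψ : HasCoordDeriv S (planeCoord X) ψ τ)
    (hτ : ∀ z ∈ S, r * e * η (ψ z) * τ z = 1)
    (hg : ∀ z ∈ S, gaussCoord X z * e = h (ψ z) + c) : IsPieceOf S X h η := by
  have hw := hX.isLocalCoord hS
  rcases S.eq_empty_or_nonempty with rfl | ⟨z₀, hz₀⟩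
  · obtain ⟨Φ, hΦ, -⟩ := exists_isSimilarity (c := 0) (b := 0) 0 hr he
    exact ⟨Φ, ψ, hΦ, contDiffOn_empty, by simp, by simp⟩
  -- The translation is chosen so that both surfaces agree at `z₀`; equality elsewhere follows from
  -- equal differentials.
  set b : ℂ := planeCoord X z₀ - r * e * W (ψ z₀) with hb
  set b₀ : ℝ := X z₀ 0 - r * ((L (ψ z₀)).re + (c * W (ψ z₀)).re) with hb₀
  have hX1 : ∀ z ∈ S, planeCoord X z = r * e * W (ψ z) + b := by
    refine hw.hasCoordDeriv_self.eqOn (k := fun z => r * e * W (ψ z) + b) ?_ hw hSc hz₀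
      (by simp [hb])
    refine (hψ.comp_hasDerivAt (φ := fun y => r * e * W y + b) (φ' := fun y => r * e * η y)
      fun z _ => ((H.right _).const_mul _).add_const b).congr_deriv hτ
  have hX0 : ∀ z ∈ S, X z 0 = r * ((L (ψ z)).re + (c * W (ψ z)).re) + b₀ := by
    have hl : HasCoordDeriv S (planeCoord X) (fun z => r * (L (ψ z) + c * W (ψ z)))
        (gaussCoord X) := by
      refine (hψ.comp_hasDerivAt (φ := fun y => r * (L y + c * W y))
        (φ' := fun y => r * (h y * η y + c * η y))
        fun z _ => ((H.left _).add ((H.right _).const_mul c)).const_mul _).congr_deriv ?_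
      intro z hz
      linear_combination gaussCoord X z * hτ z hz - r * η (ψ z) * τ z * hg z hz
    have hd1 : ∀ z ∈ S, HasFDerivAt (fun z => X z 0)
        (reCLM.comp (gaussCoord X z • fderiv ℝ (planeCoord X) z)) z := by
      intro z hz
      refine (hasFDerivAt_pi'.1 (hX.hasFDerivAt hS hz) 0).congr_fderiv ?_
      ext v
      · simpa using hX.fderiv_zero hS hz v
    have hd2 : ∀ z ∈ S, HasFDerivAt (fun z => r * ((L (ψ z)).re + (c * W (ψ z)).re) + b₀)
        (reCLM.comp (gaussCoord X z • fderiv ℝ (planeCoord X) z)) z := by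
      intro z hz
      have := (reCLM.hasFDerivAt.comp z (hl z hz)).add_const b₀
      refine this.congr_of_eventuallyEq (Eventually.of_forall fun y => ?_)
      simp
    intro z hz
    exact hS.eqOn_of_fderiv_eq hSc
      (fun x hx => (hd1 x hx).differentiableAt.differentiableWithinAt)
      (fun x hx => (hd2 x hx).differentiableAt.differentiableWithinAt)
      (fun x hx => (hd1 x hx).fderiv.trans (hd2 x hx).fderiv.symm) hz₀ (by simp [hb₀]) hz
  obtain ⟨Φ, hΦ, hΦc⟩ := exists_isSimilarity (c := c) (b := b) b₀ hr he
  refine ⟨Φ, ψ, hΦ, hψ.isCoordHolo.contDiffOn hw, fun z hz => ?_, fun z hz => ?_⟩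
  · rw [(hψ z hz).fderiv]
    have hτ0 : τ z ≠ 0 := by
      intro h0
      have := hτ z hz
      rw [h0] at this
      simp at this
    intro u v huv
    exact hw.injective z hz (mul_left_cancel₀ hτ0 (by simpa using huv))
  · rw [H.weierstrassSurface_eq, hΦc, ← hX0 z hz, ← hX1 z hz]
    ext i
    fin_cases i
    · simp [ofCoords]
    · simp [ofCoords, planeCoord]
    · simp [ofCoords, planeCoord]
    · simpa [ofCoords] using mem_isotropicSpace.1 (hX.mem z hz)

/-- A continuous logarithm of a holomorphic function is holomorphic. -/
theorem HasCoordDeriv.of_exp_eq {w F F' f : ℂ → ℂ} (hF : HasCoordDeriv S w F F') (hS : IsOpen S)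
    (hf : ContinuousOn f S) (hexp : ∀ z ∈ S, exp (f z) = F z) :
    HasCoordDeriv S w f (fun z => F' z / F z) := by
  intro z hz
  have hF0 : F z ≠ 0 := by rw [← hexp z hz]; exact exp_ne_zero _
  -- Near `z`, continuity keeps `Im (f y - f z)` in `(-π, π)`, so `f y` equals the principal
  -- logarithm of `F y / F z` plus `f z`.
  have h1 : HasDerivAt (fun y => log (y / F z) + f z) (F z)⁻¹ (F z) := by
    refine ((((hasDerivAt_id (F z)).div_const (F z)).clog ?_).add_const (f z)).congr_deriv ?_
    · simp [hF0]
    · simp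
      field_simp
  have h2 := (h1.hasFDerivAt.restrictScalars ℝ).comp z (hF z hz)
  have h3 : HasFDerivAt f _ z := h2.congr_of_eventuallyEq (f₁ := f) (by
    have hc : Tendsto (fun y => (f y - f z).im) (𝓝 z) (𝓝 0) := by
      have := (continuous_im.continuousAt (x := f z - f z)).tendsto.comp
        ((hf.continuousAt (hS.mem_nhds hz)).tendsto.sub_const (f z))
      simpa [Function.comp_def] using this
    filter_upwards [hS.mem_nhds hz, hc.eventually (isOpen_Ioo.mem_nhds
      (show (0 : ℝ) ∈ Set.Ioo (-Real.pi) Real.pi from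
        ⟨by linarith [Real.pi_pos], Real.pi_pos⟩))] with y hy1 hy2
    simp only [Function.comp_apply]
    rw [← hexp y hy1, ← hexp z hz, ← exp_sub, log_exp hy2.1 hy2.2.le]
    ring)
  refine h3.congr_fderiv ?_
  ext v
  simp
  field_simp

end

section

/-! ### The five kinds of surfaces -/

theorem isWeierstrassPrimitive_plane :
    IsWeierstrassPrimitive (fun _ => 0) (fun _ => 1) (fun _ => 0) (fun z => z) where
  left_zero := rfl
  right_zero := rfl
  left z := (hasDerivAt_const z 0).congr_deriv (by simp)
  right z := hasDerivAt_id z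

theorem isWeierstrassPrimitive_trivialEnneper :
    IsWeierstrassPrimitive (fun z => z) (fun _ => 1) (fun z => z ^ 2 / 2) (fun z => z) where
  left_zero := by simp
  right_zero := rfl
  left z := ((hasDerivAt_pow 2 z).div_const 2).congr_deriv (by simp)
  right z := hasDerivAt_id z

theorem isWeierstrassPrimitive_catenoid :
    IsWeierstrassPrimitive (fun z => exp z) (fun z => exp (-z)) (fun z => z)
      (fun z => 1 - exp (-z)) where
  left_zero := rfl
  right_zero := by simp
  left z := (hasDerivAt_id z).congr_deriv (by rw [← exp_add]; simp)
  right z := ((hasDerivAt_neg z).cexp.const_sub 1).congr_deriv (by simp)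

theorem isWeierstrassPrimitive_enneper :
    IsWeierstrassPrimitive (fun z => 1 / z) (fun z => z ^ 2) (fun z => z ^ 2 / 2)
      (fun z => z ^ 3 / 3) where
  left_zero := by simp
  right_zero := by simp
  left z := ((hasDerivAt_pow 2 z).div_const 2).congr_deriv (by
    -- At the pole of `h`, division by zero makes `h` take the value `0`; this agrees with the
    -- removable value of `h η`, which is also `0`.
    rcases eq_or_ne z 0 with rfl | hz
    · simp
    · field_simp
      simp)
  right z := ((hasDerivAt_pow 3 z).div_const 3).congr_deriv (by simp)

theorem isWeierstrassPrimitive_bonnet {α β : ℝ} (hα : 0 < α) (hβ : 0 < β) :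
    IsWeierstrassPrimitive
      (fun z => (α / β) * (cosh (α * z / 2) / sinh (α * z / 2)))
      (fun z => (2 * β / α ^ 2) * sinh (α * z / 2) ^ 2)
      (fun z => (cosh (α * z) - 1) / α ^ 2)
      (fun z => (β / α ^ 2) * (sinh (α * z) / α - z)) := by
  have hα' : (α : ℂ) ≠ 0 := by exact_mod_cast hα.ne'
  have hβ' : (β : ℂ) ≠ 0 := by exact_mod_cast hβ.ne'
  have hdbl : ∀ z : ℂ, (α : ℂ) * z = 2 * (α * z / 2) := fun z => by ring
  have hlin : ∀ z : ℂ, HasDerivAt (fun z : ℂ => (α : ℂ) * z) α z := fun z => by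
    simpa using (hasDerivAt_id z).const_mul (α : ℂ)
  refine ⟨by simp, by simp, fun z => ?_, fun z => ?_⟩
  · refine (((hlin z).ccosh.sub_const 1).div_const ((α : ℂ) ^ 2)).congr_deriv ?_
    rw [hdbl z, sinh_two_mul]
    -- At the poles of `h` the quotient reads `0`, and the derivative of `L` vanishes there as well.
    rcases eq_or_ne (sinh (2 * (α * z / 2) / 2)) 0 with hs | hs
    · have hs' : sinh (α * z / 2) = 0 := by rwa [← hdbl] at hs
      simp [hs']
    · have hs' : sinh (α * z / 2) ≠ 0 := by rwa [← hdbl] at hs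
      rw [← hdbl]
      field_simp
  · refine ((((hlin z).csinh.div_const (α : ℂ)).sub (hasDerivAt_id z)).const_mul
      ((β : ℂ) / α ^ 2)).congr_deriv ?_
    have : cosh (α * z) = 1 + 2 * sinh (α * z / 2) ^ 2 := by
      rw [hdbl z, cosh_two_mul, cosh_sq, ← hdbl]
      ring
    rw [this]
    field_simp
    ring

/-- The polynomials `P` such that the Gauss map of a surface of the given kind satisfies
`dg = P(g) dw`. -/
def IsKindPolynomial (P : ℂ[X]) : SurfaceKind → Prop
  | .plane => P = 0
  | .trivialEnneper => ∃ a ≠ 0, P = C a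
  | .catenoid => ∃ a ≠ 0, ∃ x, P = C a * (Polynomial.X - C x) ^ 2
  | .enneper => ∃ a ≠ 0, ∃ x, P = C a * (Polynomial.X - C x) ^ 4
  | .bonnet => ∃ a ≠ 0, ∃ x y, x ≠ y ∧
      P = C a * ((Polynomial.X - C x) ^ 2 * (Polynomial.X - C y) ^ 2)

/-- The degree of the polynomials belonging to a kind of surface. -/
def SurfaceKind.degree : SurfaceKind → ℕ
  | .plane => 0
  | .trivialEnneper => 0
  | .catenoid => 2
  | .enneper => 4
  | .bonnet => 4

theorem IsKindPolynomial.natDegree_eq {P : ℂ[X]} {T : SurfaceKind} (h : IsKindPolynomial P T) :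
    P.natDegree = T.degree := by
  cases T with
  | plane => cases h; simp [SurfaceKind.degree]
  | trivialEnneper => obtain ⟨a, _, rfl⟩ := h; simp [SurfaceKind.degree]
  | catenoid =>
    obtain ⟨a, ha, x, rfl⟩ := h
    rw [natDegree_C_mul ha, natDegree_pow, natDegree_X_sub_C]; rfl
  | enneper =>
    obtain ⟨a, ha, x, rfl⟩ := h
    rw [natDegree_C_mul ha, natDegree_pow, natDegree_X_sub_C]; rfl
  | bonnet =>
    obtain ⟨a, ha, x, y, -, rfl⟩ := h
    rw [natDegree_C_mul ha, natDegree_mul (pow_ne_zero _ (X_sub_C_ne_zero _))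
      (pow_ne_zero _ (X_sub_C_ne_zero _)), natDegree_pow, natDegree_pow, natDegree_X_sub_C,
      natDegree_X_sub_C]; rfl

theorem not_isKindPolynomial_enneper_bonnet {P : ℂ[X]} (h : IsKindPolynomial P .enneper)
    (h' : IsKindPolynomial P .bonnet) : False := by
  obtain ⟨a, ha, x, rfl⟩ := h
  obtain ⟨b, hb, y₁, y₂, hy, heq⟩ := h'
  have h1 := congrArg (eval y₁) heq
  have h2 := congrArg (eval y₂) heq
  simp [ha, sub_eq_zero] at h1 h2
  exact hy (h1.trans h2.symm)

theorem not_isKindPolynomial_plane_trivialEnneper {P : ℂ[X]} (h : IsKindPolynomial P .plane)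
    (h' : IsKindPolynomial P .trivialEnneper) : False := by
  obtain ⟨b, hb, heq⟩ := h'
  cases h
  exact hb (C_eq_zero.1 heq.symm)

theorem IsKindPolynomial.unique {P : ℂ[X]} {T T' : SurfaceKind} (h : IsKindPolynomial P T)
    (h' : IsKindPolynomial P T') : T = T' := by
  have hd := h.natDegree_eq.symm.trans h'.natDegree_eq
  cases T <;> cases T' <;> first
    | rfl
    | (simp [SurfaceKind.degree] at hd; done)
    | exact (not_isKindPolynomial_enneper_bonnet h h').elim
    | exact (not_isKindPolynomial_enneper_bonnet h' h).elim
    | exact (not_isKindPolynomial_plane_trivialEnneper h h').elim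
    | exact (not_isKindPolynomial_plane_trivialEnneper h' h).elim

variable {S : Set ℂ} {X : ℂ → R31} {p : ℂ → ℂ}

/-- For each model `h'/η` is a polynomial in `h`: `0`, `1`, `h²`, `-h⁴` and `-(β²/4) (h² - α²/β²)²`.
Substituting `h = g e - c` gives `P`. -/
theorem exists_isKindPolynomial (hX : IsSpacelikeImmersion S X) (hS : IsOpen S)
    (hp : HasCoordDeriv S (planeCoord X) (gaussCoord X) p) {T : SurfaceKind}
    (hT : IsPieceOfKind S X T) :
    ∃ P, IsKindPolynomial P T ∧ (∀ z ∈ S, p z = P.eval (gaussCoord X z)) ∧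
      (T ≠ .plane → ∀ z ∈ S, p z ≠ 0) := by
  cases T with
  | plane =>
    obtain ⟨r, e, c, hr, he, H⟩ := isWeierstrassPrimitive_plane.exists_of_isPieceOf hX hS hp
      (h' := fun _ => 0) (fun y _ => hasDerivAt_const y 0) hT
    refine ⟨0, rfl, fun z hz => ?_, by simp⟩
    obtain ⟨y, -, -, h⟩ := H z hz
    simpa [hr, he] using h
  | trivialEnneper =>
    obtain ⟨r, e, c, hr, he, H⟩ := isWeierstrassPrimitive_trivialEnneper.exists_of_isPieceOf
      hX hS hp (h' := fun _ => 1) (fun y _ => hasDerivAt_id y) hT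
    have hr' : (r : ℂ) ≠ 0 := by exact_mod_cast hr
    refine ⟨C (1 / (r * e ^ 2)), ⟨_, by simp [hr, he], rfl⟩, fun z hz => ?_, fun _ z hz h0 => ?_⟩
    · obtain ⟨y, -, -, h⟩ := H z hz
      rw [eval_C]
      field_simp
      linear_combination h
    · obtain ⟨y, -, -, h⟩ := H z hz
      simp [h0] at h
  | catenoid =>
    obtain ⟨r, e, c, hr, he, H⟩ := isWeierstrassPrimitive_catenoid.exists_of_isPieceOf
      hX hS hp (h' := fun z => exp z) (fun y _ => hasDerivAt_exp y) hT
    have hr' : (r : ℂ) ≠ 0 := by exact_mod_cast hr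
    refine ⟨C (1 / (r : ℂ)) * (Polynomial.X - C (c / e)) ^ 2, ⟨_, by simp [hr], _, rfl⟩,
      fun z hz => ?_, fun _ z hz h0 => ?_⟩
    · obtain ⟨y, -, h1, h⟩ := H z hz
      have h2 : exp (-y) * exp y = 1 := by rw [← exp_add]; simp
      simp
      field_simp
      have h3 : exp y = gaussCoord X z * e - c := by linear_combination -h1
      rw [← h3]
      linear_combination exp y * h - p z * r * e ^ 2 * h2
    · obtain ⟨y, -, -, h⟩ := H z hz
      simp [h0] at h
      exact exp_ne_zero y h.symm
  | enneper =>
    obtain ⟨r, e, c, hr, he, H⟩ := isWeierstrassPrimitive_enneper.exists_of_isPieceOf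
      hX hS hp (h' := fun z => -1 / z ^ 2) (fun y hy => by
        have hy' : y ≠ 0 := by rintro rfl; simp at hy
        simpa [div_eq_mul_inv] using hasDerivAt_inv hy') hT
    have hr' : (r : ℂ) ≠ 0 := by exact_mod_cast hr
    refine ⟨C (-e ^ 2 / r) * (Polynomial.X - C (c / e)) ^ 4, ⟨_, by simp [hr, he], _, rfl⟩,
      fun z hz => ?_, fun _ z hz h0 => ?_⟩
    · obtain ⟨y, hy, h1, h⟩ := H z hz
      have hy' : y ≠ 0 := by rintro rfl; simp at hy
      have h3 : gaussCoord X z = (1 / y + c) / e := by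
        field_simp at h1 ⊢
        linear_combination h1
      simp [h3]
      field_simp at h ⊢
      ring_nf at h ⊢
      linear_combination h
    · obtain ⟨y, hy, -, h⟩ := H z hz
      simp only [h0, zero_mul] at h
      exact absurd h.symm (div_ne_zero (by norm_num) hy)
  | bonnet =>
    obtain ⟨α, β, hα, hβ, hT⟩ := hT
    have hα' : (α : ℂ) ≠ 0 := by exact_mod_cast hα.ne'
    have hβ' : (β : ℂ) ≠ 0 := by exact_mod_cast hβ.ne'
    have hsne : ∀ y, (2 * β / α ^ 2) * sinh (α * y / 2) ^ 2 ≠ (0 : ℂ) → sinh (α * y / 2) ≠ 0 := by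
      intro y hy h
      simp [h] at hy
    obtain ⟨r, e, c, hr, he, H⟩ := (isWeierstrassPrimitive_bonnet hα hβ).exists_of_isPieceOf
      hX hS hp (h' := fun z => -(α ^ 2 / (2 * β)) / sinh (α * z / 2) ^ 2) (fun y hy => by
        have hs := hsne y hy
        have hlin : HasDerivAt (fun z : ℂ => (α : ℂ) * z / 2) (α / 2) y := by
          simpa using ((hasDerivAt_id y).const_mul (α : ℂ)).div_const 2
        refine ((hlin.ccosh.div hlin.csinh hs).const_mul ((α : ℂ) / β)).congr_deriv ?_
        have := cosh_sq (α * y / 2)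
        field_simp
        linear_combination -this) hT
    have hr' : (r : ℂ) ≠ 0 := by exact_mod_cast hr
    refine ⟨C (-(β ^ 2 * e ^ 2) / (4 * r)) * ((Polynomial.X - C ((c + α / β) / e)) ^ 2 *
      (Polynomial.X - C ((c - α / β) / e)) ^ 2), ⟨_, by simp [hr, he, hβ'], _, _, ?_, rfl⟩,
      fun z hz => ?_, fun _ z hz h0 => ?_⟩
    · intro h
      rw [div_left_inj' he] at h
      have : (α : ℂ) / β ≠ 0 := div_ne_zero hα' hβ'
      apply this
      linear_combination h / 2
    · obtain ⟨y, hy, h1, h⟩ := H z hz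
      have hs := hsne y hy
      have hcs := cosh_sq (α * y / 2)
      set s := sinh (α * y / 2)
      set k := cosh (α * y / 2)
      have h3 : gaussCoord X z = (α / β * (k / s) + c) / e := by
        rw [eq_div_iff he]
        exact h1
      have h4 : (gaussCoord X z - (c + α / β) / e) ^ 2 * (gaussCoord X z - (c - α / β) / e) ^ 2 =
          (α ^ 2 / (β ^ 2 * e ^ 2 * s ^ 2)) ^ 2 := by
        rw [← mul_pow]
        congr 1
        rw [h3]
        field_simp
        linear_combination (α : ℂ) ^ 2 * hcs
      simp only [eval_mul, eval_C, eval_pow, eval_sub, eval_X]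
      rw [h4]
      field_simp at h ⊢
      linear_combination h
    · obtain ⟨y, hy, -, h⟩ := H z hz
      have hs := hsne y hy
      simp only [h0, zero_mul] at h
      exact absurd h.symm (div_ne_zero (neg_ne_zero.2 (div_ne_zero (pow_ne_zero 2 hα')
        (mul_ne_zero two_ne_zero hβ'))) (pow_ne_zero 2 hs))

/-- If the two kinds gave different polynomials, `g` would take values among the finitely many roots
of their difference. Being continuous on a connected set it would be constant, so `p = 0`, which
only the plane allows. -/
theorem IsPieceOfKind.unique (hX : IsSpacelikeImmersion S X) (hS : IsOpen S)
    (hSc : IsPreconnected S) (hSne : S.Nonempty)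
    (hp : HasCoordDeriv S (planeCoord X) (gaussCoord X) p) {T T' : SurfaceKind}
    (hT : IsPieceOfKind S X T) (hT' : IsPieceOfKind S X T') : T = T' := by
  obtain ⟨P, hP, hpP, hne⟩ := exists_isKindPolynomial hX hS hp hT
  obtain ⟨P', hP', hpP', hne'⟩ := exists_isKindPolynomial hX hS hp hT'
  rcases eq_or_ne P P' with rfl | hPP
  · exact hP.unique hP'
  have hfin : (gaussCoord X '' S).Finite := by
    refine ((P - P').roots.toFinset.finite_toSet).subset ?_
    rintro _ ⟨z, hz, rfl⟩
    simp [sub_ne_zero.2 hPP, ← hpP z hz, ← hpP' z hz]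
  have hsub : (gaussCoord X '' S).Subsingleton := by
    by_contra h
    exact (hSc.image _ (hX.contDiffOn_gaussCoord hS).continuousOn).infinite_of_nontrivial
      (Set.not_subsingleton_iff.1 h) hfin
  obtain ⟨z₀, hz₀⟩ := hSne
  have hp0 : p z₀ = 0 := by
    have h1 : HasFDerivAt (gaussCoord X) (0 : ℂ →L[ℝ] ℂ) z₀ :=
      (hasFDerivAt_const (gaussCoord X z₀) z₀).congr_of_eventuallyEq (by
        filter_upwards [hS.mem_nhds hz₀] with y hy using
          hsub (Set.mem_image_of_mem _ hy) (Set.mem_image_of_mem _ hz₀))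
    have h2 := congrArg (fun L : ℂ →L[ℝ] ℂ => L 1) ((hp z₀ hz₀).unique h1)
    simpa [(hX.isLocalCoord hS).fderiv_one_ne_zero hz₀] using h2
  have h1 : T = .plane := by
    by_contra h
    exact hne h z₀ hz₀ hp0
  have h2 : T' = .plane := by
    by_contra h
    exact hne' h z₀ hz₀ hp0
  rw [h1, h2]

end

/-! ### Existence: integrating `dg = Q(g)² dw` -/

section

variable {S : Set ℂ} {X : ℂ → R31} {p : ℂ → ℂ}

/-- Simple connectedness enters here: it provides the global logarithm that serves as parameter `ψ`
for the catenoid and Bonnet types. -/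
theorem exists_log_of_hasCoordDeriv (hS : IsOpen S) (hSc : IsSimplyConnected S)
    {w F F' : ℂ → ℂ} (hF : HasCoordDeriv S w F F') (h0 : ∀ z ∈ S, F z ≠ 0) :
    ∃ ψ, HasCoordDeriv S w ψ (fun z => F' z / F z) ∧ ∀ z ∈ S, exp (ψ z) = F z := by
  obtain ⟨ψ, hψc, hψ⟩ := exists_continuousOn_eqOn_exp_comp hSc hS (g := F)
    (fun z hz => (hF z hz).continuousAt.continuousWithinAt)
    (by rintro ⟨z, hz, h⟩; exact h0 z hz h)
  exact ⟨ψ, hF.of_exp_eq hS hψc fun z hz => hψ hz, fun z hz => hψ hz⟩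

theorem isPieceOfKind_plane (hX : IsSpacelikeImmersion S X) (hS : IsOpen S)
    (hSc : IsConnected S)
    (hp : HasCoordDeriv S (planeCoord X) (gaussCoord X) p) (h0 : ∀ z ∈ S, p z = 0) :
    IsPieceOfKind S X .plane := by
  obtain ⟨z₀, hz₀⟩ := hSc.nonempty
  have hw := hX.isLocalCoord hS
  have hconst : ∀ z ∈ S, gaussCoord X z = gaussCoord X z₀ :=
    (hp.congr_deriv (k' := fun _ => 0) h0).eqOn (k := fun _ => gaussCoord X z₀)
      (fun z _ => (hasFDerivAt_const _ z).congr_fderiv (by simp)) hw hSc.isPreconnected hz₀ rfl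
  refine isWeierstrassPrimitive_plane.isPieceOf hX hS hSc.isPreconnected (r := 1) (e := 1)
    (c := gaussCoord X z₀) one_ne_zero (by simp) hw.hasCoordDeriv_self (by simp) fun z hz => ?_
  simp [hconst z hz]

theorem isPieceOfKind_trivialEnneper (hX : IsSpacelikeImmersion S X) (hS : IsOpen S)
    (hSc : IsPreconnected S) (hp : HasCoordDeriv S (planeCoord X) (gaussCoord X) p) {c : ℂ}
    (hc : c ≠ 0) (h : ∀ z ∈ S, p z = c ^ 2) : IsPieceOfKind S X .trivialEnneper := by
  have hn' : (‖c‖ : ℂ) ≠ 0 := by exact_mod_cast (norm_pos_iff.2 hc).ne'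
  have hcc : c * (starRingEnd ℂ) c = (‖c‖ : ℂ) ^ 2 := by
    rw [mul_conj, normSq_eq_norm_sq]; push_cast; rfl
  set e : ℂ := (starRingEnd ℂ) c / ‖c‖ with he
  -- The condition to meet is `r e² c² = 1` with `r` real and `|e| = 1`: `e` cancels the argument of
  -- `c`, and `r` its modulus.
  refine isWeierstrassPrimitive_trivialEnneper.isPieceOf hX hS hSc (r := (‖c‖ ^ 2)⁻¹) (e := e)
    (c := 0) (by positivity) ?_ (ψ := fun z => gaussCoord X z * e) (τ := fun z => p z * e)
    (fun z hz => ((hp z hz).mul_const e).congr_fderiv ?_) (fun z hz => ?_) (fun z _ => by simp)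
  · rw [he, normSq_div, normSq_conj, normSq_ofReal, normSq_eq_norm_sq, ← pow_two]
    have : ‖c‖ ≠ 0 := (norm_pos_iff.2 hc).ne'
    field_simp
  · ext v
    simp
    ring
  · simp only [h z hz, he]
    push_cast
    field_simp
    rw [← mul_pow, mul_comm _ c, hcc]
    ring

/-- Take `ψ = log (g - x)`, so that `h ∘ ψ = g - x`. The remaining condition is `r D = 1`, solvable
by a real ratio because `D` is real. -/
theorem isPieceOfKind_catenoid (hX : IsSpacelikeImmersion S X) (hS : IsOpen S)
    (hSc : IsSimplyConnected S) (hp : HasCoordDeriv S (planeCoord X) (gaussCoord X) p)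
    {x : ℂ} {D : ℝ} (hD : D ≠ 0)
    (h : ∀ z ∈ S, p z = D * (gaussCoord X z - x) ^ 2 ∧ gaussCoord X z - x ≠ 0) :
    IsPieceOfKind S X .catenoid := by
  have hD' : (D : ℂ) ≠ 0 := by exact_mod_cast hD
  have hF : HasCoordDeriv S (planeCoord X) (fun z => gaussCoord X z - x) p := fun z hz =>
    (hp z hz).sub_const x
  obtain ⟨ψ, hψ, hexp⟩ := exists_log_of_hasCoordDeriv hS hSc hF fun z hz => (h z hz).2
  refine isWeierstrassPrimitive_catenoid.isPieceOf hX hS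
    hSc.isPathConnected.isConnected.isPreconnected (r := D⁻¹) (e := 1)
    (c := x) (inv_ne_zero hD) (by simp) hψ (fun z hz => ?_) (fun z hz => ?_)
  · have := (h z hz).2
    simp only [exp_neg, hexp z hz, (h z hz).1]
    push_cast
    field_simp
  · simp only [hexp z hz]
    ring

theorem isPieceOfKind_enneper (hX : IsSpacelikeImmersion S X) (hS : IsOpen S)
    (hSc : IsPreconnected S) (hp : HasCoordDeriv S (planeCoord X) (gaussCoord X) p)
    {a x : ℂ} (ha : a ≠ 0)
    (h : ∀ z ∈ S, p z = (a * (gaussCoord X z - x) ^ 2) ^ 2 ∧ gaussCoord X z - x ≠ 0) :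
    IsPieceOfKind S X .enneper := by
  have hn' : (‖a‖ : ℂ) ≠ 0 := by exact_mod_cast (norm_pos_iff.2 ha).ne'
  set e : ℂ := a / ‖a‖ with he
  have he0 : e ≠ 0 := div_ne_zero ha hn'
  have hψ : HasCoordDeriv S (planeCoord X) (fun z => ((gaussCoord X z - x) * e)⁻¹)
      (fun z => -(p z * e) / ((gaussCoord X z - x) * e) ^ 2) := by
    intro z hz
    have h1 := ((hp z hz).sub_const x).mul_const e
    have h2 := (hasDerivAt_inv (mul_ne_zero (h z hz).2 he0)).hasFDerivAt.restrictScalars ℝ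
    refine (h2.comp z h1).congr_fderiv ?_
    ext v
    simp
    ring
  -- With `ψ = 1 / ((g - x) e)` the condition becomes `-r a² = e²`.
  refine isWeierstrassPrimitive_enneper.isPieceOf hX hS hSc (r := -(‖a‖ ^ 2)⁻¹) (e := e)
    (c := x * e) (by simpa using ha) ?_ hψ (fun z hz => ?_) (fun z hz => ?_)
  · rw [he, normSq_div, normSq_ofReal, normSq_eq_norm_sq, ← pow_two]
    have : ‖a‖ ≠ 0 := (norm_pos_iff.2 ha).ne'
    field_simp
  · have := (h z hz).2
    simp only [(h z hz).1]
    push_cast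
    field_simp
    rw [he]
    field_simp
  · simp
    ring

/-- The two simple roots of `Q` are `x ± d`. Taking `ψ` to be a logarithm of `(g - x + d) / (g - x -
d)` gives `g - x = d coth (ψ / 2)`. -/
theorem isPieceOfKind_bonnet (hX : IsSpacelikeImmersion S X) (hS : IsOpen S)
    (hSc : IsSimplyConnected S) (hp : HasCoordDeriv S (planeCoord X) (gaussCoord X) p)
    {a x d : ℂ} {D : ℝ} (hD : D ≠ 0) (had : 4 * a ^ 2 * d ^ 2 = D)
    (h : ∀ z ∈ S, p z = (a * ((gaussCoord X z - x) ^ 2 - d ^ 2)) ^ 2 ∧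
      (gaussCoord X z - x) ^ 2 - d ^ 2 ≠ 0) :
    IsPieceOfKind S X .bonnet := by
  have hD' : (D : ℂ) ≠ 0 := by exact_mod_cast hD
  have hd : d ≠ 0 := by
    rintro rfl
    simp at had
    exact hD' had.symm
  have hn : ‖d‖ ≠ 0 := (norm_pos_iff.2 hd).ne'
  have hn' : (‖d‖ : ℂ) ≠ 0 := by exact_mod_cast hn
  have hfac : ∀ z ∈ S, gaussCoord X z - x + d ≠ 0 ∧ gaussCoord X z - x - d ≠ 0 := by
    intro z hz
    have := (h z hz).2
    rw [sq_sub_sq] at this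
    exact mul_ne_zero_iff.1 this
  have hF : HasCoordDeriv S (planeCoord X)
      (fun z => (gaussCoord X z - x + d) / (gaussCoord X z - x - d))
      (fun z => -2 * d / (gaussCoord X z - x - d) ^ 2 * p z) := by
    refine hp.comp_hasDerivAt (φ := fun y => (y - x + d) / (y - x - d))
      (φ' := fun y => -2 * d / (y - x - d) ^ 2) fun z hz => ?_
    have h1 := ((hasDerivAt_id (gaussCoord X z)).sub_const x).add_const d
    have h2 := ((hasDerivAt_id (gaussCoord X z)).sub_const x).sub_const d
    refine (h1.div h2 (hfac z hz).2).congr_deriv ?_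
    simp
    ring
  obtain ⟨ψ, hψ, hexp⟩ := exists_log_of_hasCoordDeriv hS hSc hF fun z hz =>
    div_ne_zero (hfac z hz).1 (hfac z hz).2
  have hhalf : ∀ z ∈ S, sinh (ψ z / 2) ≠ 0 ∧
      d * (cosh (ψ z / 2) / sinh (ψ z / 2)) = gaussCoord X z - x ∧
      sinh (ψ z / 2) ^ 2 * ((gaussCoord X z - x) ^ 2 - d ^ 2) = d ^ 2 := by
    intro z hz
    obtain ⟨h1, h2⟩ := hfac z hz
    have e1 : exp (ψ z) = exp (ψ z / 2) ^ 2 := by rw [← exp_nat_mul]; congr 1; push_cast; ring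
    have e2 := hexp z hz
    rw [e1, ← cosh_add_sinh, eq_div_iff h2] at e2
    have e3 := cosh_sq (ψ z / 2)
    set k := cosh (ψ z / 2)
    set s := sinh (ψ z / 2)
    set G := gaussCoord X z - x
    have hks : k + s ≠ 0 := by
      intro h0
      rw [h0] at e2
      apply h1
      linear_combination -e2
    have hGs : G * s = d * k := by
      have : (2 * (k + s)) * (G * s - d * k) = 0 := by
        linear_combination e2 + (-d - G) * e3
      exact sub_eq_zero.1 ((mul_eq_zero.1 this).resolve_left (mul_ne_zero two_ne_zero hks))
    have hs : s ≠ 0 := by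
      intro h0
      rw [h0, mul_zero] at hGs
      have hk := (mul_eq_zero.1 hGs.symm).resolve_left hd
      apply hks
      rw [h0, hk, add_zero]
    refine ⟨hs, ?_, ?_⟩
    · field_simp
      linear_combination -hGs
    · linear_combination (G * s + d * k) * hGs + d ^ 2 * e3
  -- Rescaling the parameter and a homothety normalize `α` to `1`. The rotation `e` turns `d` into
  -- `‖d‖ = 1/β`, and real `D` makes the ratio `-1/D` real.
  refine ⟨1, ‖d‖⁻¹, one_pos, by positivity, ?_⟩
  have H := isWeierstrassPrimitive_bonnet (α := 1) (β := ‖d‖⁻¹) one_pos (by positivity)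
  refine H.isPieceOf hX hS hSc.isPathConnected.isConnected.isPreconnected (r := -D⁻¹)
    (e := ‖d‖ / d) (c := x * (‖d‖ / d)) (neg_ne_zero.2 (inv_ne_zero hD)) ?_ hψ
    (fun z hz => ?_) (fun z hz => ?_)
  · rw [normSq_div, normSq_ofReal, normSq_eq_norm_sq, ← pow_two]
    field_simp
  · obtain ⟨hs, -, hs2⟩ := hhalf z hz
    obtain ⟨h1, h2⟩ := hfac z hz
    rw [(h z hz).1]
    push_cast
    simp only [one_mul]
    have hs3 : sinh (ψ z / 2) ^ 2 =
        d ^ 2 / ((gaussCoord X z - x + d) * (gaussCoord X z - x - d)) := by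
      rw [eq_div_iff (mul_ne_zero h1 h2), ← hs2]
      ring
    rw [hs3, sq_sub_sq]
    field_simp
    linear_combination had
  · obtain ⟨hs, hG, -⟩ := hhalf z hz
    push_cast
    simp only [one_mul]
    have : gaussCoord X z = d * (cosh (ψ z / 2) / sinh (ψ z / 2)) + x := by
      linear_combination -hG
    rw [this]
    field_simp

theorem exists_isPieceOfKind (hX : IsSpacelikeImmersion S X) (hS : IsOpen S)
    (hSc : IsSimplyConnected S) (hp : HasCoordDeriv S (planeCoord X) (gaussCoord X) p)
    (hP : HasPlanarCurvatureLines S X) : ∃ T, IsPieceOfKind S X T := by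
  have hconn := hSc.isPathConnected.isConnected
  rcases exists_quadratic hX hS hconn.isPreconnected hp hP with h0 | ⟨a, b, c, D, hD, h⟩
  · exact ⟨_, isPieceOfKind_plane hX hS hconn hp h0⟩
  obtain ⟨z₀, hz₀⟩ := hconn.nonempty
  rcases eq_or_ne a 0 with rfl | ha
  · rcases eq_or_ne b 0 with rfl | hb
    · refine ⟨_, isPieceOfKind_trivialEnneper hX hS hconn.isPreconnected hp (c := c) ?_
        fun z hz => ?_⟩
      · simpa using (h z₀ hz₀).2
      · simpa using (h z hz).1
    · have hbD : (D : ℂ) = b ^ 2 := by rw [← hD]; ring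
      have hQ : ∀ y, b * (y - -c / b) = 0 * y ^ 2 + b * y + c := by
        intro y
        field_simp
        ring
      refine ⟨_, isPieceOfKind_catenoid hX hS hSc hp (x := -c / b) (D := D) ?_
        fun z hz => ⟨?_, ?_⟩⟩
      · have : (D : ℂ) ≠ 0 := hbD ▸ pow_ne_zero 2 hb
        exact_mod_cast this
      · rw [(h z hz).1, ← hQ, hbD]
        ring
      · have := (h z hz).2
        rw [← hQ] at this
        exact right_ne_zero_of_mul this
  · have hQ : ∀ y, a * y ^ 2 + b * y + c =
        a * ((y - -b / (2 * a)) ^ 2 - D / (4 * a ^ 2)) := by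
      intro y
      rw [← hD]
      field_simp
      ring
    rcases eq_or_ne D 0 with rfl | hD0
    · simp only [ofReal_zero, zero_div, sub_zero] at hQ
      refine ⟨_, isPieceOfKind_enneper hX hS hconn.isPreconnected hp ha (x := -b / (2 * a))
        fun z hz => ⟨?_, ?_⟩⟩
      · rw [(h z hz).1, hQ]
      · have := (h z hz).2
        rw [hQ] at this
        exact fun h0 => this (by rw [h0]; simp)
    -- Completing the square, `d` is half the difference of the two roots of `Q`.
    · obtain ⟨d, hd⟩ := IsAlgClosed.exists_pow_nat_eq ((D : ℂ) / (4 * a ^ 2)) (n := 2) (by norm_num)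
      refine ⟨_, isPieceOfKind_bonnet hX hS hSc hp (a := a) (x := -b / (2 * a)) (d := d) hD0 ?_
        fun z hz => ⟨?_, ?_⟩⟩
      · rw [hd]
        field_simp
      · rw [(h z hz).1, hQ, hd]
      · have := (h z hz).2
        rw [hQ, ← hd] at this
        exact right_ne_zero_of_mul this

end

end

end IsotropicZMC

theorem theorem3p7 (S : Set ℂ) (hS : IsOpen S) (hSc : IsSimplyConnected S)
    (X : ℂ → IsotropicZMC.R31) (hX : IsotropicZMC.IsSpacelikeImmersion S X)
    (hH : ∀ z ∈ S, IsotropicZMC.meanCurvature X z = 0)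
    (hP : IsotropicZMC.HasPlanarCurvatureLines S X) :
    ∃! T : IsotropicZMC.SurfaceKind, IsotropicZMC.IsPieceOfKind S X T := by
  obtain ⟨p, hp⟩ := hX.exists_hasCoordDeriv_gaussCoord hS hH
  obtain ⟨T, hT⟩ := IsotropicZMC.exists_isPieceOfKind hX hS hSc hp hP
  have hconn := hSc.isPathConnected.isConnected
  exact ⟨T, hT, fun T' hT' => IsotropicZMC.IsPieceOfKind.unique hX hS hconn.isPreconnected
    hconn.nonempty hp hT' hT⟩
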